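/- Let $M$ be a smooth (Hausdorff) finite-dimensional manifold with a regular Poisson structure $w$, i.e. a smooth Poisson bivector field of constant rank, and let $\sharp_w : T^*M \to TM$ be given by $\beta(\sharp_w\alpha) = w(\alpha,\beta)$. Let $\nabla$ be a Poisson connection on $(M,w)$, i.e. a smooth torsion-free linear connection on $M$ with $\nabla w = 0$, with curvature $R_\nabla(X,Y)Z = \nabla_X\nabla_Y Z - \nabla_Y\nabla_X Z - \nabla_{[X,Y]}Z$. In canonical coordinates $(x^i,p_i)$ of $T^*M$ let $\frac{\delta}{\delta x^i} = \frac{\partial}{\partial x^i} + p_k\Gamma^k_{ij}\frac{\partial}{\partial p_j}$, where $\Gamma^k_{ij}$ are the coefficients of $\nabla$; this is the horizontal lift of $\frac{\partial}{\partial x^i}$ with respect to $\nabla$. Let $$w^H = \tfrac12\, w^{ij}(x)\,\frac{\delta}{\delta x^i}\wedge\frac{\delta}{\delta x^j}$$ be the horizontal lift of $w$, a bivector field on $T^*M$, and let $W_0 = \frac{\partial}{\partial p_i}\wedge\frac{\partial}{\partial x^i}$ be the canonical Poisson structure of $T^*M$, determined by the symplectic form $\omega = dp_i\wedge dx^i$.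 Then $w^H$ is a Poisson structure on $T^*M$ that is compatible with $W_0$ (i.e. the Schouten–Nijenhuis bracket $[w^H, W_0]$ vanishes) if and only if for every smooth 1-form $\alpha$ on $M$ the $TM$-valued 2-form $$(X,Y) \longmapsto R_\nabla(X,Y)(\sharp_w\alpha), \qquad X, Y \text{ smooth vector fields on } M,$$ vanishes. -/

import Mathlib

open Bundle
open scoped Manifold ContDiff Topology

noncomputable section

section Bivector

variable {F : Type*} [NormedAddCommGroup F] [NormedSpace ℝ F]
  {H : Type*} [TopologicalSpace H] {J : ModelWithCorners ℝ F H}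
  {N : Type*} [TopologicalSpace N] [ChartedSpace H N]

/-- A (not necessarily continuous) section `α` of the cotangent bundle is smooth at `x`. -/
def SmoothOneFormAt [IsManifold J ∞ N] (α : ∀ y : N, TangentSpace J y →L[ℝ] ℝ) (x : N) : Prop :=
  ContMDiffAt J (J.prod 𝓘(ℝ, F →L[ℝ] ℝ)) ∞
    (fun y ↦ TotalSpace.mk' (F →L[ℝ] ℝ) (E := fun y : N ↦ TangentSpace J y →L[ℝ] ℝ) y (α y)) x

/-- Smooth vector fields. -/
def IsSmoothVectorField [IsManifold J ∞ N] (X : ∀ y : N, TangentSpace J y) : Prop :=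
  ContMDiff J (J.prod 𝓘(ℝ, F)) ∞ (fun y ↦ TotalSpace.mk' F y (X y))

variable (J N) in
/-- Fields of bilinear forms on the cotangent spaces, i.e. (in finite dimension) contravariant
tensor fields of order two; those that are bivector fields are singled out below. -/
abbrev ContravariantTwoTensor : Type _ :=
  ∀ x : N, (TangentSpace J x →L[ℝ] ℝ) →L[ℝ] (TangentSpace J x →L[ℝ] ℝ) →L[ℝ] ℝ

/-- `P` is a smooth bivector field: it is skew-symmetric, and `P(α, β)` is smooth
wherever the 1-forms `α` and `β` are. -/
structure IsBivectorField [IsManifold J ∞ N] (P : ContravariantTwoTensor J N) : Prop where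
  smooth : ∀ (α β : ∀ y : N, TangentSpace J y →L[ℝ] ℝ) (x : N),
    SmoothOneFormAt α x → SmoothOneFormAt β x →
      ContMDiffAt J 𝓘(ℝ, ℝ) ∞ (fun y ↦ P y (α y) (β y)) x
  skew : ∀ (x : N) (α β : TangentSpace J x →L[ℝ] ℝ), P x α β = -P x β α

/-- `{f, g}_P = P(df, dg)`. -/
def poissonBracket (P : ContravariantTwoTensor J N) (f g : N → ℝ) (x : N) : ℝ :=
  P x (mvfderiv J f x) (mvfderiv J g x)

/-- `P` is a Poisson structure: a smooth bivector field whose bracket satisfies the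
Jacobi identity. -/
structure IsPoisson [IsManifold J ∞ N] (P : ContravariantTwoTensor J N) : Prop where
  isBivectorField : IsBivectorField P
  jacobi : ∀ f g h : N → ℝ, ContMDiff J 𝓘(ℝ, ℝ) ∞ f → ContMDiff J 𝓘(ℝ, ℝ) ∞ g →
    ContMDiff J 𝓘(ℝ, ℝ) ∞ h → ∀ x : N,
      poissonBracket P (poissonBracket P f g) h x + poissonBracket P (poissonBracket P g h) f x
        + poissonBracket P (poissonBracket P h f) g x = 0

/-- The value on `(df, dg, dh)` of the Schouten-Nijenhuis bracket `[P, Q]` of two bivector fields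
(up to the overall sign, which depends on conventions). -/
def schoutenBracket (P Q : ContravariantTwoTensor J N) (f g h : N → ℝ) (x : N) : ℝ :=
  poissonBracket Q (poissonBracket P f g) h x + poissonBracket Q (poissonBracket P g h) f x
    + poissonBracket Q (poissonBracket P h f) g x
    + poissonBracket P (poissonBracket Q f g) h x + poissonBracket P (poissonBracket Q g h) f x
    + poissonBracket P (poissonBracket Q h f) g x

/-- Two Poisson structures are compatible if `[P, Q] = 0`, i.e. if `P + Q` is again Poisson. -/
def AreCompatible (P Q : ContravariantTwoTensor J N) : Prop :=
  ∀ f g h : N → ℝ, ContMDiff J 𝓘(ℝ, ℝ) ∞ f → ContMDiff J 𝓘(ℝ, ℝ) ∞ g →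
    ContMDiff J 𝓘(ℝ, ℝ) ∞ h → ∀ x : N, schoutenBracket P Q f g h x = 0

/-- `P` is regular: its rank is the same at all points. -/
def IsRegularBivector (P : ContravariantTwoTensor J N) : Prop :=
  ∀ x y : N, Module.finrank ℝ (P x).range = Module.finrank ℝ (P y).range

/-- The vector `♯_P α`, determined by `β(♯_P α) = P(α, β)` for all `β`; see `apply_sharp`. -/
def bivectorSharp [FiniteDimensional ℝ F] (P : ContravariantTwoTensor J N) (x : N)
    (α : TangentSpace J x →L[ℝ] ℝ) : TangentSpace J x :=
  haveI : FiniteDimensional ℝ (TangentSpace J x) := inferInstanceAs (FiniteDimensional ℝ F)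
  haveI : T2Space (TangentSpace J x) := inferInstanceAs (T2Space F)
  (Module.evalEquiv ℝ (TangentSpace J x)).symm
    ((P x α).toLinearMap ∘ₗ
      (LinearMap.toContinuousLinearMap :
        (TangentSpace J x →ₗ[ℝ] ℝ) ≃ₗ[ℝ] (TangentSpace J x →L[ℝ] ℝ)).toLinearMap)

theorem apply_sharp [FiniteDimensional ℝ F] (P : ContravariantTwoTensor J N) (x : N)
    (α β : TangentSpace J x →L[ℝ] ℝ) : β (bivectorSharp P x α) = P x α β := by
  have : FiniteDimensional ℝ (TangentSpace J x) := inferInstanceAs (FiniteDimensional ℝ F)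
  have : T2Space (TangentSpace J x) := inferInstanceAs (T2Space F)
  exact Module.apply_evalEquiv_symm_apply ℝ (TangentSpace J x) β.toLinearMap
    ((P x α).toLinearMap ∘ₗ
      (LinearMap.toContinuousLinearMap :
        (TangentSpace J x →ₗ[ℝ] ℝ) ≃ₗ[ℝ] (TangentSpace J x →L[ℝ] ℝ)).toLinearMap)

end Bivector

section Connection

variable {E : Type*} [NormedAddCommGroup E] [NormedSpace ℝ E]
  {M : Type*} [TopologicalSpace M] [ChartedSpace E M] [IsManifold 𝓘(ℝ, E) ∞ M]

theorem tensorialAt_covDerivOneForm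
    (cov : CovariantDerivative 𝓘(ℝ, E) E (TangentSpace 𝓘(ℝ, E) : M → Type _))
    {α : ∀ y : M, TangentSpace 𝓘(ℝ, E) y →L[ℝ] ℝ} {x : M}
    (hα : MDifferentiableAt 𝓘(ℝ, E) (𝓘(ℝ, E).prod 𝓘(ℝ, E →L[ℝ] ℝ))
      (fun y ↦ TotalSpace.mk' (E →L[ℝ] ℝ)
        (E := fun y : M ↦ TangentSpace 𝓘(ℝ, E) y →L[ℝ] ℝ) y (α y)) x)
    (v : TangentSpace 𝓘(ℝ, E) x) :
    TensorialAt 𝓘(ℝ, E) E (fun Y : ∀ y : M, TangentSpace 𝓘(ℝ, E) y ↦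
      (mvfderiv 𝓘(ℝ, E) (fun y ↦ α y (Y y)) x v - α x (cov Y x v) : ℝ)) x := by
  have key : ∀ {Y : ∀ y : M, TangentSpace 𝓘(ℝ, E) y}, MDiffAt (T% Y) x →
      MDiffAt (fun y ↦ α y (Y y)) x := by
    intro Y hY
    have := hα.clm_bundle_apply (F₁ := E) (F₂ := ℝ) (E₂ := Trivial M ℝ) hY
    rw [mdifferentiableAt_totalSpace] at this
    exact this.2
  constructor
  · intro f Y hf hY
    have h1 : (fun y ↦ α y ((f • Y) y)) = f • (fun y ↦ α y (Y y)) := by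
      ext y; simp
    rw [h1, mvfderiv_smul hf (key hY), cov.isCovariantDerivativeOn.leibniz hY hf]
    simp
    ring
  · intro Y Z hY hZ
    have h1 : (fun y ↦ α y ((Y + Z) y)) = (fun y ↦ α y (Y y)) + (fun y ↦ α y (Z y)) := by
      ext y; simp
    rw [h1, mvfderiv_add (key hY) (key hZ), cov.isCovariantDerivativeOn.add hY hZ]
    simp
    ring

variable [FiniteDimensional ℝ E]

/-- The covariant derivative `∇_v α` of a 1-form `α` differentiable at `x`, for `v ∈ T_x M`:
`(∇_v α)(Y) = v(α(Y)) - α(∇_v Y)`; see `covDerivOneForm_apply`. -/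
def covDerivOneForm (cov : CovariantDerivative 𝓘(ℝ, E) E (TangentSpace 𝓘(ℝ, E) : M → Type _))
    {α : ∀ y : M, TangentSpace 𝓘(ℝ, E) y →L[ℝ] ℝ} {x : M}
    (hα : MDifferentiableAt 𝓘(ℝ, E) (𝓘(ℝ, E).prod 𝓘(ℝ, E →L[ℝ] ℝ))
      (fun y ↦ TotalSpace.mk' (E →L[ℝ] ℝ)
        (E := fun y : M ↦ TangentSpace 𝓘(ℝ, E) y →L[ℝ] ℝ) y (α y)) x)
    (v : TangentSpace 𝓘(ℝ, E) x) : TangentSpace 𝓘(ℝ, E) x →L[ℝ] ℝ :=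
  TensorialAt.mkHom _ x (tensorialAt_covDerivOneForm cov hα v)

theorem covDerivOneForm_apply
    (cov : CovariantDerivative 𝓘(ℝ, E) E (TangentSpace 𝓘(ℝ, E) : M → Type _))
    {α : ∀ y : M, TangentSpace 𝓘(ℝ, E) y →L[ℝ] ℝ} {x : M}
    (hα : MDifferentiableAt 𝓘(ℝ, E) (𝓘(ℝ, E).prod 𝓘(ℝ, E →L[ℝ] ℝ))
      (fun y ↦ TotalSpace.mk' (E →L[ℝ] ℝ)
        (E := fun y : M ↦ TangentSpace 𝓘(ℝ, E) y →L[ℝ] ℝ) y (α y)) x)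
    (v : TangentSpace 𝓘(ℝ, E) x) {Y : ∀ y : M, TangentSpace 𝓘(ℝ, E) y}
    (hY : MDifferentiableAt 𝓘(ℝ, E) (𝓘(ℝ, E).prod 𝓘(ℝ, E)) (fun y ↦ TotalSpace.mk' E y (Y y)) x) :
    covDerivOneForm cov hα v (Y x)
      = mvfderiv 𝓘(ℝ, E) (fun y ↦ α y (Y y)) x v - α x (cov Y x v) :=
  TensorialAt.mkHom_apply (tensorialAt_covDerivOneForm cov hα v) hY

theorem covDerivOneForm_add
    (cov : CovariantDerivative 𝓘(ℝ, E) E (TangentSpace 𝓘(ℝ, E) : M → Type _))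
    {α : ∀ y : M, TangentSpace 𝓘(ℝ, E) y →L[ℝ] ℝ} {x : M}
    (hα : MDifferentiableAt 𝓘(ℝ, E) (𝓘(ℝ, E).prod 𝓘(ℝ, E →L[ℝ] ℝ))
      (fun y ↦ TotalSpace.mk' (E →L[ℝ] ℝ)
        (E := fun y : M ↦ TangentSpace 𝓘(ℝ, E) y →L[ℝ] ℝ) y (α y)) x)
    (u v : TangentSpace 𝓘(ℝ, E) x) :
    covDerivOneForm cov hα (u + v) = covDerivOneForm cov hα u + covDerivOneForm cov hα v := by
  apply ContinuousLinearMap.ext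
  intro Y
  simp only [covDerivOneForm, TensorialAt.mkHom_apply_eq_extend, add_apply, map_add]
  ring

theorem covDerivOneForm_smul
    (cov : CovariantDerivative 𝓘(ℝ, E) E (TangentSpace 𝓘(ℝ, E) : M → Type _))
    {α : ∀ y : M, TangentSpace 𝓘(ℝ, E) y →L[ℝ] ℝ} {x : M}
    (hα : MDifferentiableAt 𝓘(ℝ, E) (𝓘(ℝ, E).prod 𝓘(ℝ, E →L[ℝ] ℝ))
      (fun y ↦ TotalSpace.mk' (E →L[ℝ] ℝ)
        (E := fun y : M ↦ TangentSpace 𝓘(ℝ, E) y →L[ℝ] ℝ) y (α y)) x)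
    (c : ℝ) (v : TangentSpace 𝓘(ℝ, E) x) :
    covDerivOneForm cov hα (c • v) = c • covDerivOneForm cov hα v := by
  apply ContinuousLinearMap.ext
  intro Y
  simp only [covDerivOneForm, TensorialAt.mkHom_apply_eq_extend, smul_apply, map_smul, smul_eq_mul]
  ring

/-- `∇` is a Poisson connection for `w`: a smooth symmetric (torsion-free) linear connection
with `∇w = 0`, where `(∇_v w)(α, β) = v(w(α, β)) - w(∇_v α, β) - w(α, ∇_v β)`. -/
structure IsPoissonConnection
    (cov : CovariantDerivative 𝓘(ℝ, E) E (TangentSpace 𝓘(ℝ, E) : M → Type _))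
    (w : ContravariantTwoTensor 𝓘(ℝ, E) M) : Prop where
  smooth : CovariantDerivative.ContMDiffCovariantDerivative cov ∞
  torsion_free : cov.torsion = 0
  parallel : ∀ (α β : ∀ y : M, TangentSpace 𝓘(ℝ, E) y →L[ℝ] ℝ) (x : M)
    (hα : SmoothOneFormAt α x) (hβ : SmoothOneFormAt β x) (v : TangentSpace 𝓘(ℝ, E) x),
    mvfderiv 𝓘(ℝ, E) (fun y ↦ w y (α y) (β y)) x v
      - w x (covDerivOneForm cov (hα.mdifferentiableAt (by simp)) v) (β x)
      - w x (α x) (covDerivOneForm cov (hβ.mdifferentiableAt (by simp)) v) = 0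

/-- The curvature `R(X, Y)Z = ∇_X ∇_Y Z - ∇_Y ∇_X Z - ∇_[X, Y] Z`. -/
def connectionCurvature (cov : CovariantDerivative 𝓘(ℝ, E) E (TangentSpace 𝓘(ℝ, E) : M → Type _))
    (X Y Z : ∀ y : M, TangentSpace 𝓘(ℝ, E) y) (x : M) : TangentSpace 𝓘(ℝ, E) x :=
  cov (fun y ↦ cov Z y (Y y)) x (X x) - cov (fun y ↦ cov Z y (X y)) x (Y x)
    - cov Z x (VectorField.mlieBracket 𝓘(ℝ, E) X Y x)

end Connection

section Cotangent

variable {E : Type*} [NormedAddCommGroup E] [NormedSpace ℝ E]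
  {M : Type*} [TopologicalSpace M] [ChartedSpace E M]

variable (E M) in
/-- The cotangent bundle `T*M`, with Mathlib's topology and atlas. -/
abbrev CotangentBundle : Type _ :=
  TotalSpace (E →L[ℝ] ℝ) (fun x : M ↦ TangentSpace 𝓘(ℝ, E) x →L[ℝ] ℝ)

variable (E) in
/-- The model with corners of `T*M`. -/
abbrev cotangentModel : ModelWithCorners ℝ (E × (E →L[ℝ] ℝ)) (ModelProd E (E →L[ℝ] ℝ)) :=
  𝓘(ℝ, E).prod 𝓘(ℝ, E →L[ℝ] ℝ)

variable [IsManifold 𝓘(ℝ, E) ∞ M]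

/- In what follows `T_ξ(T*M)` is identified with `E × E*` through the preferred chart at `ξ`, as
everywhere in Mathlib. The next lemma says that this chart consists of the canonical coordinates
`(x^i, p_i)` belonging to the preferred chart of `M` at the base point of `ξ`. Thus `(v, 0)` is
`v^i ∂/∂x^i` and `(0, a)` is the vertical vector `a_i ∂/∂p_i`. -/
theorem extChartAt_cotangent_apply (ξ η : CotangentBundle E M) :
    extChartAt (cotangentModel E) ξ η =
      (chartAt E ξ.1 η.1,
        η.2.comp ((trivializationAt E (TangentSpace 𝓘(ℝ, E)) ξ.1).symmL ℝ η.1)) := by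
  rw [FiberBundle.extChartAt]
  simp [hom_trivializationAt_apply, ContinuousLinearMap.inCoordinates]

theorem symmL_self (x : M) : (trivializationAt E (TangentSpace 𝓘(ℝ, E)) x).symmL ℝ x = ContinuousLinearMap.id ℝ E := by
    rw [TangentBundle.symmL_trivializationAt (by simp), mfderivWithin_range_extChartAt_symm]
    rfl

variable (x : M) (p : E →L[ℝ] ℝ) in
theorem hasMFDerivAt_fiber_cotangent :
    HasMFDerivAt 𝓘(ℝ, E →L[ℝ] ℝ) (cotangentModel E) (fun a : E →L[ℝ] ℝ ↦ (⟨x, a⟩ : CotangentBundle E M)) p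
      (ContinuousLinearMap.inr ℝ E (E →L[ℝ] ℝ)) := by
  constructor
  · exact (FiberBundle.continuous_totalSpaceMk (E →L[ℝ] ℝ) (fun x : M ↦ TangentSpace 𝓘(ℝ, E) x →L[ℝ] ℝ) x).continuousAt
  · have : writtenInExtChartAt 𝓘(ℝ, E →L[ℝ] ℝ) (cotangentModel E) p (fun a : E →L[ℝ] ℝ ↦ (⟨x, a⟩ : CotangentBundle E M)) = fun a => (chartAt E x x, a) := by
      ext1 a
      simp only [writtenInExtChartAt, Function.comp_def]
      rw [extChartAt_cotangent_apply]
      dsimp only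
      rw [symmL_self]
      rfl
    rw [this]
    exact (hasFDerivAt_prodMk_right _ _).hasFDerivWithinAt

theorem hasMFDerivAt_extend_cotangent (x : M) (p : TangentSpace 𝓘(ℝ, E) x →L[ℝ] ℝ) :
    HasMFDerivAt 𝓘(ℝ, E) (cotangentModel E) (fun y : M ↦ (⟨y, FiberBundle.extend (E →L[ℝ] ℝ) (E := fun x : M ↦ TangentSpace 𝓘(ℝ, E) x →L[ℝ] ℝ) p y⟩ : CotangentBundle E M)) x
      (ContinuousLinearMap.inl ℝ E (E →L[ℝ] ℝ)) := by
  constructor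
  · exact (FiberBundle.mdifferentiableAt_extend 𝓘(ℝ, E) (E →L[ℝ] ℝ) (V := fun x : M ↦ TangentSpace 𝓘(ℝ, E) x →L[ℝ] ℝ) p).continuousAt
  · refine HasFDerivAt.hasFDerivWithinAt ?_
    have : writtenInExtChartAt 𝓘(ℝ, E) (cotangentModel E) x (fun y : M ↦ (⟨y, FiberBundle.extend (E →L[ℝ] ℝ) (E := fun x : M ↦ TangentSpace 𝓘(ℝ, E) x →L[ℝ] ℝ) p y⟩ : CotangentBundle E M))
        =ᶠ[𝓝 (extChartAt 𝓘(ℝ, E) x x)] fun z => (z, p) := by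
      filter_upwards [extChartAt_target_mem_nhds (I := 𝓘(ℝ, E)) x] with z hz
      have hz' : (chartAt E x).symm z ∈ (trivializationAt (E →L[ℝ] ℝ) (fun x : M ↦ TangentSpace 𝓘(ℝ, E) x →L[ℝ] ℝ) x).baseSet := by
        simp only [mfld_simps] at hz
        simp [hz]
      simp only [writtenInExtChartAt, Function.comp_def, FiberBundle.extend_apply_self, FiberBundle.extChartAt, PartialEquiv.trans_apply]
      have h3 : (trivializationAt (E →L[ℝ] ℝ) (fun x : M ↦ TangentSpace 𝓘(ℝ, E) x →L[ℝ] ℝ) x ⟨x, p⟩).2 = p := by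
        rw [hom_trivializationAt_apply]
        simp [ContinuousLinearMap.inCoordinates, symmL_self]
        rfl
      have h4 := (trivializationAt (E →L[ℝ] ℝ) (fun x : M ↦ TangentSpace 𝓘(ℝ, E) x →L[ℝ] ℝ) x).apply_mk_symm hz' p
      simp only [mfld_simps] at hz ⊢
      unfold FiberBundle.extend
      rw [h3]
      erw [h4]
      simp [hz]
    refine HasFDerivAt.congr_of_eventuallyEq ?_ this
    exact hasFDerivAt_prodMk_left _ _

section ExtDeriv

variable {F : Type*} [NormedAddCommGroup F] [NormedSpace ℝ F]
  {H : Type*} [TopologicalSpace H] (J : ModelWithCorners ℝ F H)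
  {N : Type*} [TopologicalSpace N] [ChartedSpace H N]

/-- The 1-form `θ` read in the preferred chart at `x`, i.e. its pullback under the inverse of
that chart. -/
def oneFormInChart (θ : ∀ x : N, TangentSpace J x →L[ℝ] ℝ) (x : N) (z : F) : F →L[ℝ] ℝ :=
  (θ ((extChartAt J x).symm z)).comp
    (mfderivWithin 𝓘(ℝ, F) J (extChartAt J x).symm (Set.range J) z)

/-- The exterior derivative `(dθ)_x(u, v)` of a 1-form, computed in the preferred chart at `x`. -/
def extDerivOneForm (θ : ∀ x : N, TangentSpace J x →L[ℝ] ℝ) (x : N) (u v : TangentSpace J x) : ℝ :=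
  fderivWithin ℝ (oneFormInChart J θ x) (Set.range J) (extChartAt J x x) u v -
    fderivWithin ℝ (oneFormInChart J θ x) (Set.range J) (extChartAt J x x) v u
end ExtDeriv

/-- The Liouville form `λ = p_i dx^i`: `λ_ξ(U) = ξ(dπ U)`. -/
def liouvilleForm (ξ : CotangentBundle E M) : TangentSpace (cotangentModel E) ξ →L[ℝ] ℝ :=
  ξ.2.comp (mfderiv (cotangentModel E) 𝓘(ℝ, E) (TotalSpace.proj : CotangentBundle E M → M) ξ)

theorem liouville_chart (ξ : CotangentBundle E M) {z : E × (E →L[ℝ] ℝ)} (hz : z ∈ (extChartAt (cotangentModel E) ξ).target) :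
    oneFormInChart (cotangentModel E) (liouvilleForm (E := E) (M := M)) ξ z = z.2.comp (ContinuousLinearMap.fst ℝ E (E →L[ℝ] ℝ)) := by
  have h1 := (extChartAt (cotangentModel E) ξ).right_inv hz
  have h2 := (extChartAt (cotangentModel E) ξ).map_target hz
  have hd : MDifferentiableAt 𝓘(ℝ, E × (E →L[ℝ] ℝ)) (cotangentModel E) (extChartAt (cotangentModel E) ξ).symm z := by
    have := mdifferentiableWithinAt_extChartAt_symm (I := cotangentModel E) hz
    simpa only [ModelWithCorners.range_eq_univ, mdifferentiableWithinAt_univ] using this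
  unfold oneFormInChart liouvilleForm
  set η := (extChartAt (cotangentModel E) ξ).symm z with hη
  rw [extChartAt_cotangent_apply] at h1
  have hs : η.1 ∈ (chartAt E ξ.1).source := by
    rw [FiberBundle.extChartAt] at h2
    have := h2.2
    simp only [mfld_simps] at h2
    simpa using h2.1
  have hy : chartAt E ξ.1 η.1 = z.1 := congrArg Prod.fst h1
  have hp : η.2.comp ((trivializationAt E (TangentSpace 𝓘(ℝ, E)) ξ.1).symmL ℝ η.1) = z.2 := congrArg Prod.snd h1
  rw [ModelWithCorners.range_eq_univ, mfderivWithin_univ]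
  have hπ : MDifferentiableAt (cotangentModel E) 𝓘(ℝ, E) (TotalSpace.proj : CotangentBundle E M → M) η :=
    mdifferentiableAt_proj _
  have hc : (mfderiv (cotangentModel E) 𝓘(ℝ, E) (TotalSpace.proj : CotangentBundle E M → M) η).comp
     (mfderiv 𝓘(ℝ, E × (E →L[ℝ] ℝ)) (cotangentModel E) (extChartAt (cotangentModel E) ξ).symm z) = 
     (mfderiv 𝓘(ℝ, E) 𝓘(ℝ, E) (extChartAt 𝓘(ℝ, E) ξ.1).symm z.1).comp (ContinuousLinearMap.fst ℝ E (E →L[ℝ] ℝ)) := by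
    rw [← mfderiv_comp z hπ hd]
    have h5 : (TotalSpace.proj : CotangentBundle E M → M) ∘ (extChartAt (cotangentModel E) ξ).symm
        =ᶠ[𝓝 z] (extChartAt 𝓘(ℝ, E) ξ.1).symm ∘ Prod.fst := by
      have ho : (extChartAt (cotangentModel E) ξ).target ∈ 𝓝 z :=
        (isOpen_extChartAt_target ξ).mem_nhds hz
      filter_upwards [ho] with z' hz'
      have h6 := (extChartAt (cotangentModel E) ξ).right_inv hz'
      have h7 := (extChartAt (cotangentModel E) ξ).map_target hz'
      rw [extChartAt_cotangent_apply] at h6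
      rw [FiberBundle.extChartAt] at h7
      simp only [mfld_simps] at h7
      have h8 : ((extChartAt (cotangentModel E) ξ).symm z').1 ∈ (chartAt E ξ.1).source := by
        rw [FiberBundle.extChartAt]
        simpa only [mfld_simps] using h7.1.1
      have h9 := congrArg Prod.fst h6
      exact ((chartAt E ξ.1).left_inv h8).symm.trans (congrArg (chartAt E ξ.1).symm h9)
    have h10 : MDifferentiableAt 𝓘(ℝ, E) 𝓘(ℝ, E) (extChartAt 𝓘(ℝ, E) ξ.1).symm z.1 := by
      have h11 : z.1 ∈ (extChartAt 𝓘(ℝ, E) ξ.1).target := by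
        rw [← hy]
        simp [hs]
      have := mdifferentiableWithinAt_extChartAt_symm (I := 𝓘(ℝ, E)) h11
      simpa only [ModelWithCorners.range_eq_univ, mdifferentiableWithinAt_univ] using this
    have h12 : HasMFDerivAt 𝓘(ℝ, E × (E →L[ℝ] ℝ)) 𝓘(ℝ, E) (Prod.fst : E × (E →L[ℝ] ℝ) → E) z (ContinuousLinearMap.fst ℝ E (E →L[ℝ] ℝ)) :=
      hasFDerivAt_fst.hasMFDerivAt
    rw [h5.mfderiv_eq, mfderiv_comp z h10 h12.mdifferentiableAt, h12.mfderiv]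
    rfl
  apply ContinuousLinearMap.ext
  intro w
  have hw := DFunLike.congr_fun hc (show TangentSpace 𝓘(ℝ, E × (E →L[ℝ] ℝ)) z from w)
  have hp' : ∀ u : E, η.2 ((trivializationAt E (TangentSpace 𝓘(ℝ, E)) ξ.1).symmL ℝ η.1 u) = z.2 u :=
    fun u => DFunLike.congr_fun hp u
  rw [TangentBundle.symmL_trivializationAt hs, ModelWithCorners.range_eq_univ, mfderivWithin_univ] at hp'
  have hy' : extChartAt 𝓘(ℝ, E) ξ.1 η.1 = z.1 := hy
  rw [hy'] at hp'
  exact (congrArg η.2 hw).trans (hp' w.1)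

/-- The canonical symplectic form `ω = dλ`. -/
def symplecticForm (ξ : CotangentBundle E M) (U V : TangentSpace (cotangentModel E) ξ) : ℝ :=
  extDerivOneForm (cotangentModel E) (liouvilleForm (E := E) (M := M)) ξ U V

set_option maxSynthPendingDepth 3 in
/-- `ω = dp_i ∧ dx^i`. -/
theorem symplecticForm_apply (ξ : CotangentBundle E M) (U V : TangentSpace (cotangentModel E) ξ) :
    symplecticForm ξ U V =
      (show E × (E →L[ℝ] ℝ) from U).2 (show E × (E →L[ℝ] ℝ) from V).1 -
      (show E × (E →L[ℝ] ℝ) from V).2 (show E × (E →L[ℝ] ℝ) from U).1 := by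
  have h : oneFormInChart (cotangentModel E) (liouvilleForm (E := E) (M := M)) ξ
      =ᶠ[𝓝 (extChartAt (cotangentModel E) ξ ξ)]
      fun z => z.2.comp (ContinuousLinearMap.fst ℝ E (E →L[ℝ] ℝ)) := by
    filter_upwards [extChartAt_target_mem_nhds (I := cotangentModel E) ξ] with z hz
    exact liouville_chart ξ hz
  have h2 : HasFDerivAt (fun z : E × (E →L[ℝ] ℝ) => z.2.comp (ContinuousLinearMap.fst ℝ E (E →L[ℝ] ℝ)))
     ((ContinuousLinearMap.precomp ℝ (ContinuousLinearMap.fst ℝ E (E →L[ℝ] ℝ))).comp (ContinuousLinearMap.snd ℝ E (E →L[ℝ] ℝ))) (extChartAt (cotangentModel E) ξ ξ) :=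
    ((ContinuousLinearMap.precomp ℝ (ContinuousLinearMap.fst ℝ E (E →L[ℝ] ℝ))).comp (ContinuousLinearMap.snd ℝ E (E →L[ℝ] ℝ))).hasFDerivAt
  unfold symplecticForm extDerivOneForm
  rw [ModelWithCorners.range_eq_univ, fderivWithin_univ, h.fderiv_eq, h2.fderiv]
  rfl

set_option maxSynthPendingDepth 3 in
variable (E M) in
/-- The canonical Poisson bivector `W_0 = ♯_ω ω = ∂/∂p_i ∧ ∂/∂x^i` of the cotangent bundle:
`W_0(Φ, Ψ) = Φ(∂/∂p_i) Ψ(∂/∂x^i) - Ψ(∂/∂p_i) Φ(∂/∂x^i)`. -/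
def canonicalPoisson : ContravariantTwoTensor (cotangentModel E) (CotangentBundle E M) := fun _ ↦
  let A : (E × (E →L[ℝ] ℝ) →L[ℝ] ℝ) →L[ℝ] (E × (E →L[ℝ] ℝ) →L[ℝ] ℝ) →L[ℝ] ℝ :=
    (ContinuousLinearMap.precomp ℝ
      (ContinuousLinearMap.precomp ℝ (ContinuousLinearMap.inl ℝ E (E →L[ℝ] ℝ)))).comp
      (ContinuousLinearMap.precomp ℝ (ContinuousLinearMap.inr ℝ E (E →L[ℝ] ℝ)))
  A - A.flip

theorem canonicalPoisson_apply (ξ : CotangentBundle E M) (Φ Ψ : E × (E →L[ℝ] ℝ) →L[ℝ] ℝ) :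
    canonicalPoisson E M ξ Φ Ψ =
      Φ (0, Ψ.comp (ContinuousLinearMap.inl ℝ E (E →L[ℝ] ℝ))) -
        Ψ (0, Φ.comp (ContinuousLinearMap.inl ℝ E (E →L[ℝ] ℝ))) := rfl

/-- `W_0(Φ, Ψ) = ω(♯Φ, ♯Ψ)`, where `U = ♯Φ` means `i_U ω = Φ` and `ω = dλ`. -/
theorem canonicalPoisson_eq_symplecticForm (ξ : CotangentBundle E M)
    (Φ Ψ : TangentSpace (cotangentModel E) ξ →L[ℝ] ℝ) (U V : TangentSpace (cotangentModel E) ξ)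
    (hU : ∀ Z, symplecticForm ξ U Z = Φ Z) (hV : ∀ Z, symplecticForm ξ V Z = Ψ Z) :
    canonicalPoisson E M ξ Φ Ψ = symplecticForm ξ U V := by
  simp only [symplecticForm_apply] at hU hV
  have hΦ : Φ.comp (ContinuousLinearMap.inl ℝ E (E →L[ℝ] ℝ)) = (show E × (E →L[ℝ] ℝ) from U).2 := by
    apply ContinuousLinearMap.ext
    intro v
    have h := hU (show E × (E →L[ℝ] ℝ) from (v, 0))
    refine Eq.trans ?_ (h.symm.trans ?_)
    · rfl
    · simp
  have hΨ : Ψ.comp (ContinuousLinearMap.inl ℝ E (E →L[ℝ] ℝ)) = (show E × (E →L[ℝ] ℝ) from V).2 := by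
    apply ContinuousLinearMap.ext
    intro v
    have h := hV (show E × (E →L[ℝ] ℝ) from (v, 0))
    refine Eq.trans ?_ (h.symm.trans ?_)
    · rfl
    · simp
  have h1 := hU (show E × (E →L[ℝ] ℝ) from (0, (show E × (E →L[ℝ] ℝ) from V).2))
  have h2 := hV (show E × (E →L[ℝ] ℝ) from (0, (show E × (E →L[ℝ] ℝ) from U).2))
  have h3 := canonicalPoisson_apply ξ Φ Ψ
  erw [hΦ, hΨ] at h3
  rw [symplecticForm_apply]
  refine h3.trans ?_
  erw [← h1, ← h2]
  simp
  ring

theorem clm_prod_apply_neg {G₁ G₂ G₃ : Type*} [NormedAddCommGroup G₁] [NormedSpace ℝ G₁]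
    [NormedAddCommGroup G₂] [NormedSpace ℝ G₂] [NormedAddCommGroup G₃] [NormedSpace ℝ G₃]
    (D : G₁ × G₂ →L[ℝ] G₃) (v : G₁) (c : G₂) : D (v, -c) = D (v, 0) - D (0, c) := by
  rw [← map_sub]
  simp

theorem hasMFDerivAt_comp_cotangent (x : M) (p : E →L[ℝ] ℝ) {G : Type*} [NormedAddCommGroup G]
    [NormedSpace ℝ G] {K : Type*} [TopologicalSpace K] {L : ModelWithCorners ℝ G K}
    {N : Type*} [TopologicalSpace N] [ChartedSpace K N] {f : CotangentBundle E M → N}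
    (D : E × (E →L[ℝ] ℝ) →L[ℝ] G)
    (hf : HasMFDerivAt (cotangentModel E) L f (⟨x, p⟩ : CotangentBundle E M) D) :
    HasMFDerivAt 𝓘(ℝ, E) L (fun y : M ↦ f ⟨y, FiberBundle.extend (E →L[ℝ] ℝ)
      (E := fun y : M ↦ TangentSpace 𝓘(ℝ, E) y →L[ℝ] ℝ) (x := x) p y⟩) x
        (D.comp (ContinuousLinearMap.inl ℝ E (E →L[ℝ] ℝ))) ∧
    HasMFDerivAt 𝓘(ℝ, E →L[ℝ] ℝ) L (fun a : E →L[ℝ] ℝ ↦ f ⟨x, a⟩) p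
        (D.comp (ContinuousLinearMap.inr ℝ E (E →L[ℝ] ℝ))) := by
  constructor
  · have aux : ∀ η : CotangentBundle E M, η = ⟨x, p⟩ → HasMFDerivAt (cotangentModel E) L f η D := by
      rintro _ rfl
      exact hf
    refine HasMFDerivAt.comp x (aux _ ?_) (hasMFDerivAt_extend_cotangent x p)
    exact congrArg (TotalSpace.mk x) (FiberBundle.extend_apply_self (E →L[ℝ] ℝ)
      (E := fun y : M ↦ TangentSpace 𝓘(ℝ, E) y →L[ℝ] ℝ) (x := x) p)
  · exact HasMFDerivAt.comp p hf (hasMFDerivAt_fiber_cotangent x p)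

variable [FiniteDimensional ℝ E]

/-- The horizontal lift `T_x M → T_ξ(T*M)` at `ξ ∈ T*_x M` given by `∇`: if `σ` is the 1-form near
`x` with `σ(x) = ξ` and constant coefficients in the canonical coordinates, then
`v^H = dσ(v) - (∇_v σ)^vertical = (v, -∇_v σ)`. As `(∇_i σ)_j = -p_k Γ^k_ij = N_ij`, this is
`(∂/∂x^i)^H = ∂/∂x^i - N_ij ∂/∂p_j`. It is characterized by `horizontalLift_proj` and
`horizontalLift_momentum` below. -/
def horizontalLift (cov : CovariantDerivative 𝓘(ℝ, E) E (TangentSpace 𝓘(ℝ, E) : M → Type _))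
    (ξ : CotangentBundle E M) :
    TangentSpace 𝓘(ℝ, E) ξ.1 →L[ℝ] TangentSpace (cotangentModel E) ξ :=
  haveI : FiniteDimensional ℝ (TangentSpace 𝓘(ℝ, E) ξ.1) := inferInstanceAs (FiniteDimensional ℝ E)
  haveI : T2Space (TangentSpace 𝓘(ℝ, E) ξ.1) := inferInstanceAs (T2Space E)
  LinearMap.toContinuousLinearMap
    { toFun v := ((v, -covDerivOneForm cov
          (FiberBundle.mdifferentiableAt_extend 𝓘(ℝ, E) (E →L[ℝ] ℝ)
            (V := fun y : M ↦ TangentSpace 𝓘(ℝ, E) y →L[ℝ] ℝ) ξ.2) v) : E × (E →L[ℝ] ℝ))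
      map_add' u v := by
        rw [covDerivOneForm_add, neg_add]
        exact Prod.ext rfl rfl
      map_smul' c v := by
        rw [covDerivOneForm_smul]
        exact Prod.ext rfl (smul_neg _ _).symm }

/-- The horizontal lift of `v` projects to `v`. -/
theorem horizontalLift_proj
    (cov : CovariantDerivative 𝓘(ℝ, E) E (TangentSpace 𝓘(ℝ, E) : M → Type _))
    (ξ : CotangentBundle E M) (v : TangentSpace 𝓘(ℝ, E) ξ.1) :
    mfderiv (cotangentModel E) 𝓘(ℝ, E) (TotalSpace.proj : CotangentBundle E M → M) ξ
      (horizontalLift cov ξ v) = v := by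
  have h0 : MDifferentiableAt (cotangentModel E) 𝓘(ℝ, E)
      (TotalSpace.proj : CotangentBundle E M → M) ξ := mdifferentiableAt_proj _
  obtain ⟨h1, h2⟩ := hasMFDerivAt_comp_cotangent (E := E) (G := E) ξ.1 ξ.2 _ h0.hasMFDerivAt
  have e1 := hasMFDerivAt_unique h1 (hasMFDerivAt_id ξ.1)
  have e2 := hasMFDerivAt_unique h2 (hasMFDerivAt_const ξ.1 _)
  have e1' : ∀ u : E, (mfderiv (cotangentModel E) 𝓘(ℝ, E)
    (TotalSpace.proj : CotangentBundle E M → M) ξ : E × (E →L[ℝ] ℝ) →L[ℝ] E) (u, 0) = u :=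
    fun u ↦ DFunLike.congr_fun e1 u
  have e2' : ∀ a : E →L[ℝ] ℝ, (mfderiv (cotangentModel E) 𝓘(ℝ, E)
    (TotalSpace.proj : CotangentBundle E M → M) ξ : E × (E →L[ℝ] ℝ) →L[ℝ] E) (0, a) = 0 :=
    fun a ↦ DFunLike.congr_fun e2 a
  have e3 : ∀ z : E × (E →L[ℝ] ℝ), (mfderiv (cotangentModel E) 𝓘(ℝ, E)
    (TotalSpace.proj : CotangentBundle E M → M) ξ : E × (E →L[ℝ] ℝ) →L[ℝ] E) z = z.1 := by
    intro z
    have h := clm_prod_apply_neg (G₁ := E) (G₂ := E →L[ℝ] ℝ) (G₃ := E) (mfderiv (cotangentModel E) 𝓘(ℝ, E)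
      (TotalSpace.proj : CotangentBundle E M → M) ξ : E × (E →L[ℝ] ℝ) →L[ℝ] E) z.1 (-z.2)
    have h' := h.trans (congrArg₂ (· - ·) (e1' z.1) (e2' (-z.2)))
    rw [neg_neg] at h'
    exact h'.trans (sub_zero z.1)
  exact e3 _

/-- The derivative of the momentum `m(X)(ξ) = ξ(X)` of `X` along the horizontal lift of `v` is
`m(∇_v X)`. -/
theorem horizontalLift_momentum
    (cov : CovariantDerivative 𝓘(ℝ, E) E (TangentSpace 𝓘(ℝ, E) : M → Type _))
    (ξ : CotangentBundle E M) (v : TangentSpace 𝓘(ℝ, E) ξ.1)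
    {X : ∀ y : M, TangentSpace 𝓘(ℝ, E) y} (hX : IsSmoothVectorField X) :
    mvfderiv (cotangentModel E) (fun η : CotangentBundle E M ↦ η.2 (X η.1)) ξ
      (horizontalLift cov ξ v) = ξ.2 (cov X ξ.1 v) := by
  have hX' : MDiffAt (T% X) ξ.1 := (hX ξ.1).mdifferentiableAt (by simp)
  have hm : MDifferentiableAt (cotangentModel E) 𝓘(ℝ, ℝ)
      (fun η : CotangentBundle E M ↦ η.2 (X η.1)) ξ := by
    have h0 : MDifferentiableAt (cotangentModel E) 𝓘(ℝ, E)
      (TotalSpace.proj : CotangentBundle E M → M) ξ := mdifferentiableAt_proj _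
    have h1 : MDifferentiableAt (cotangentModel E) (𝓘(ℝ, E).prod 𝓘(ℝ, E))
        (fun η : CotangentBundle E M ↦ TotalSpace.mk' E η.1 (X η.1)) ξ :=
      MDifferentiableAt.comp ξ hX' h0
    have h2 : MDifferentiableAt (cotangentModel E) (𝓘(ℝ, E).prod 𝓘(ℝ, E →L[ℝ] ℝ))
        (fun η : CotangentBundle E M ↦ TotalSpace.mk' (E →L[ℝ] ℝ)
          (E := fun y : M ↦ TangentSpace 𝓘(ℝ, E) y →L[ℝ] ℝ) η.1 η.2) ξ := mdifferentiableAt_id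
    have := h2.clm_bundle_apply (F₁ := E) (F₂ := ℝ) (E₂ := Trivial M ℝ) h1
    rw [mdifferentiableAt_totalSpace] at this
    exact this.2
  obtain ⟨h1, h2⟩ := hasMFDerivAt_comp_cotangent (E := E) (G := ℝ) ξ.1 ξ.2 _ hm.hasMFDerivAt
  have h3 := covDerivOneForm_apply cov (FiberBundle.mdifferentiableAt_extend 𝓘(ℝ, E) (E →L[ℝ] ℝ)
    (V := fun y : M ↦ TangentSpace 𝓘(ℝ, E) y →L[ℝ] ℝ) ξ.2) v hX'
  rw [FiberBundle.extend_apply_self] at h3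
  have e2 := hasMFDerivAt_unique h2
    (ContinuousLinearMap.apply ℝ ℝ (show E from X ξ.1)).hasFDerivAt.hasMFDerivAt
  set D : E × (E →L[ℝ] ℝ) →L[ℝ] ℝ := mfderiv (cotangentModel E) 𝓘(ℝ, ℝ)
    (fun η : CotangentBundle E M ↦ η.2 (X η.1)) ξ with hD
  set c : E →L[ℝ] ℝ := covDerivOneForm cov
    (FiberBundle.mdifferentiableAt_extend 𝓘(ℝ, E) (E →L[ℝ] ℝ)
      (V := fun y : M ↦ TangentSpace 𝓘(ℝ, E) y →L[ℝ] ℝ) ξ.2) v with hc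
  have e1 : D (v, 0) = mvfderiv 𝓘(ℝ, E) (fun y : M ↦ FiberBundle.extend (E →L[ℝ] ℝ)
      (E := fun y : M ↦ TangentSpace 𝓘(ℝ, E) y →L[ℝ] ℝ) ξ.2 y (X y)) ξ.1 v :=
    (DFunLike.congr_fun h1.mfderiv v).symm
  have e2' : D (0, c) = c (X ξ.1) := DFunLike.congr_fun e2 c
  have e3 : D (v, -c) = D (v, 0) - D (0, c) := clm_prod_apply_neg D v c
  refine Eq.trans (show _ = D (v, -c) from rfl) ?_
  rw [e3, e1, e2']
  have h4 : c (X ξ.1) = _ := h3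
  rw [h4]
  ring

/-- The horizontal lift `w^H` of `w` to `T*M`: `w^H(Φ, Ψ) = w(Φ ∘ h, Ψ ∘ h)` with `h` the
horizontal lift of vectors, i.e. `w^H = (1/2) w^ij δ/δx^i ∧ δ/δx^j`, `δ/δx^i = (∂/∂x^i)^H`. -/
def horizontalLiftTensor
    (cov : CovariantDerivative 𝓘(ℝ, E) E (TangentSpace 𝓘(ℝ, E) : M → Type _))
    (w : ContravariantTwoTensor 𝓘(ℝ, E) M) :
    ContravariantTwoTensor (cotangentModel E) (CotangentBundle E M) := fun ξ ↦
  (ContinuousLinearMap.precomp ℝ (ContinuousLinearMap.precomp ℝ (horizontalLift cov ξ))).comp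
    ((w ξ.1).comp (ContinuousLinearMap.precomp ℝ (horizontalLift cov ξ)))

theorem horizontalLiftTensor_apply
    (cov : CovariantDerivative 𝓘(ℝ, E) E (TangentSpace 𝓘(ℝ, E) : M → Type _))
    (w : ContravariantTwoTensor 𝓘(ℝ, E) M) (ξ : CotangentBundle E M)
    (Φ Ψ : TangentSpace (cotangentModel E) ξ →L[ℝ] ℝ) :
    horizontalLiftTensor cov w ξ Φ Ψ
      = w ξ.1 (Φ.comp (horizontalLift cov ξ)) (Ψ.comp (horizontalLift cov ξ)) := rfl

end Cotangent

end

/-!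
In canonical coordinates the Schouten bracket of two bivectors `P₁`, `P₂`, evaluated on three
covectors, is the cyclic sum of the derivatives of the components of `P₁` along the `P₂`-sharps of
the covectors, plus the same with `P₁` and `P₂` exchanged. The canonical Poisson structure `W₀` has
constant components, so only the derivatives of `w^H` along `W₀`-sharps contribute to `[w^H, W₀]`.
As `∇w = 0`, the derivatives of `w` combine with those of the Christoffel symbols into curvature:
if `Φ`, `Ψ`, `Θ` have vertical parts `a`, `b`, `c` and their restrictions to the horizontal space
have `w`-sharps `r`, `s`, `t`, then `[w^H, W₀](Φ, Ψ, Θ) = p(R(b, c)r + R(c, a)s + R(a, b)t)` at the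
covector `p`. Taking `Φ` with `a = 0` and `Ψ`, `Θ` vanishing on the horizontal space isolates
`p(R(b, c)r)`, and `p` and `r = ♯α` are arbitrary. Similarly `[w^H, w^H](Φ, Ψ, Θ)` is a combination
of `p(R(s, t)a)`, `p(R(t, r)b)` and `p(R(r, s)c)`; here two arguments are sharps, so by the Bianchi
identity these terms vanish as soon as `R` vanishes on sharps in its third argument.
-/

noncomputable section

set_option maxSynthPendingDepth 3

section VectorSpace

variable {V : Type*} [NormedAddCommGroup V] [NormedSpace ℝ V]

variable (V) in
/-- Contravariant two-tensors at a point of a vector space: bilinear forms on the dual. -/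
abbrev DualBilinForm : Type _ := StrongDual ℝ V →L[ℝ] StrongDual ℝ V →L[ℝ] ℝ

/-- The bracket `{f, g} = P(df, dg)` of functions on a vector space; `poissonBracket` becomes this
in a chart. -/
def vectorSpaceBracket (P : V → DualBilinForm V) (f g : V → ℝ) (z : V) : ℝ :=
  P z (fderiv ℝ f z) (fderiv ℝ g z)

theorem fderiv_apply_apply {F₁ F₂ F₃ : Type*} [NormedAddCommGroup F₁] [NormedSpace ℝ F₁]
    [NormedAddCommGroup F₂] [NormedSpace ℝ F₂] [NormedAddCommGroup F₃] [NormedSpace ℝ F₃]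
    {A : V → F₁ →L[ℝ] F₂ →L[ℝ] F₃} {z : V} (hA : DifferentiableAt ℝ A z) (u : V) (a : F₁) (b : F₂) :
    fderiv ℝ A z u a b = fderiv ℝ (fun y ↦ A y a b) z u := by
  rw [((hA.hasFDerivAt.clm_apply (hasFDerivAt_const a z)).clm_apply
    (hasFDerivAt_const b z)).fderiv]
  simp

variable {P P₁ P₂ : V → DualBilinForm V} {f g h : V → ℝ} {z : V}

theorem differentiableAt_fderiv_of_contDiffAt (hf : ContDiffAt ℝ 2 f z) :
    DifferentiableAt ℝ (fderiv ℝ f) z :=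
  (hf.fderiv_right (m := 1) (by norm_num)).differentiableAt (by simp)

theorem differentiableAt_vectorSpaceBracket (hP : DifferentiableAt ℝ P z)
    (hf : ContDiffAt ℝ 2 f z) (hg : ContDiffAt ℝ 2 g z) :
    DifferentiableAt ℝ (vectorSpaceBracket P f g) z :=
  (hP.clm_apply (differentiableAt_fderiv_of_contDiffAt hf)).clm_apply
    (differentiableAt_fderiv_of_contDiffAt hg)

theorem fderiv_vectorSpaceBracket (hP : DifferentiableAt ℝ P z)
    (hf : ContDiffAt ℝ 2 f z) (hg : ContDiffAt ℝ 2 g z) (u : V) :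
    fderiv ℝ (vectorSpaceBracket P f g) z u =
      fderiv ℝ P z u (fderiv ℝ f z) (fderiv ℝ g z)
        + P z (fderiv ℝ (fderiv ℝ f) z u) (fderiv ℝ g z)
        + P z (fderiv ℝ f z) (fderiv ℝ (fderiv ℝ g) z u) := by
  have hf' := (differentiableAt_fderiv_of_contDiffAt hf).hasFDerivAt
  have hg' := (differentiableAt_fderiv_of_contDiffAt hg).hasFDerivAt
  unfold vectorSpaceBracket
  rw [((hP.hasFDerivAt.clm_apply hf').clm_apply hg').fderiv]
  simp only [add_apply, ContinuousLinearMap.comp_apply, ContinuousLinearMap.flip_apply]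
  ring

variable [FiniteDimensional ℝ V]

variable (V) in
/-- The inverse of the evaluation map from `V` to its bidual. -/
def bidualInv : StrongDual ℝ (StrongDual ℝ V) →L[ℝ] V :=
  LinearMap.toContinuousLinearMap
    ((Module.evalEquiv ℝ V).symm.toLinearMap ∘ₗ
      { toFun a := a.toLinearMap ∘ₗ
          (LinearMap.toContinuousLinearMap : (V →ₗ[ℝ] ℝ) ≃ₗ[ℝ] StrongDual ℝ V).toLinearMap
        map_add' _ _ := rfl
        map_smul' _ _ := rfl })

@[simp]
theorem apply_bidualInv (a : StrongDual ℝ (StrongDual ℝ V)) (q : StrongDual ℝ V) :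
    q (bidualInv V a) = a q :=
  Module.apply_evalEquiv_symm_apply ℝ V q.toLinearMap
    (a.toLinearMap ∘ₗ
      (LinearMap.toContinuousLinearMap : (V →ₗ[ℝ] ℝ) ≃ₗ[ℝ] StrongDual ℝ V).toLinearMap)

/-- The vector `♯α` with `β(♯α) = B(α, β)`; the vector space version of `bivectorSharp`. -/
def sharp (B : DualBilinForm V) (α : StrongDual ℝ V) : V :=
  bidualInv V (B α)

theorem apply_sharp_eq (B : DualBilinForm V) (α β : StrongDual ℝ V) : β (sharp B α) = B α β :=
  apply_bidualInv _ _

theorem sharp_eq_iff {B : DualBilinForm V} {α : StrongDual ℝ V} {v : V} :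
    sharp B α = v ↔ ∀ β : StrongDual ℝ V, B α β = β v :=
  ⟨fun h β ↦ by rw [← apply_sharp_eq, h], fun h ↦
    (SeparatingDual.eq_iff_forall_dual_eq (R := ℝ)).mpr fun β ↦ by rw [apply_sharp_eq, h]⟩

/-- The cyclic sum of `(D_{♯Θ} P)(Φ, Ψ)`, the sharp being that of `B`. For skew fields `P₁` and `P₂`
the Schouten bracket is, up to sign, this expression in `P₁, P₂` plus the one in `P₂, P₁`. -/
def cyclicSharpDeriv (P : V → DualBilinForm V) (B : DualBilinForm V) (z : V)
    (Φ Ψ Θ : StrongDual ℝ V) : ℝ :=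
  fderiv ℝ P z (sharp B Θ) Φ Ψ + fderiv ℝ P z (sharp B Φ) Ψ Θ + fderiv ℝ P z (sharp B Ψ) Θ Φ

theorem vectorSpaceBracket_eq_neg_fderiv_sharp (skew : ∀ Φ Ψ, P z Φ Ψ = -P z Ψ Φ) (f g : V → ℝ) :
    vectorSpaceBracket P f g z = -fderiv ℝ f z (sharp (P z) (fderiv ℝ g z)) := by
  rw [apply_sharp_eq, vectorSpaceBracket, skew]

theorem sum_vectorSpaceBracket_vectorSpaceBracket
    (hP₁ : DifferentiableAt ℝ P₁ z) (hP₂ : DifferentiableAt ℝ P₂ z)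
    (skew₁ : ∀ Φ Ψ, P₁ z Φ Ψ = -P₁ z Ψ Φ) (skew₂ : ∀ Φ Ψ, P₂ z Φ Ψ = -P₂ z Ψ Φ)
    (hf : ContDiffAt ℝ 2 f z) (hg : ContDiffAt ℝ 2 g z) (hh : ContDiffAt ℝ 2 h z) :
    vectorSpaceBracket P₂ (vectorSpaceBracket P₁ f g) h z
      + vectorSpaceBracket P₂ (vectorSpaceBracket P₁ g h) f z
      + vectorSpaceBracket P₂ (vectorSpaceBracket P₁ h f) g z
      + vectorSpaceBracket P₁ (vectorSpaceBracket P₂ f g) h z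
      + vectorSpaceBracket P₁ (vectorSpaceBracket P₂ g h) f z
      + vectorSpaceBracket P₁ (vectorSpaceBracket P₂ h f) g z =
    -(cyclicSharpDeriv P₁ (P₂ z) z (fderiv ℝ f z) (fderiv ℝ g z) (fderiv ℝ h z)
      + cyclicSharpDeriv P₂ (P₁ z) z (fderiv ℝ f z) (fderiv ℝ g z) (fderiv ℝ h z)) := by
  have snd_symm {k : V → ℝ} (hk : ContDiffAt ℝ 2 k z) (α β : StrongDual ℝ V) :
      fderiv ℝ (fderiv ℝ k) z (sharp (P₁ z) α) (sharp (P₂ z) β) =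
        fderiv ℝ (fderiv ℝ k) z (sharp (P₂ z) β) (sharp (P₁ z) α) :=
    (hk.isSymmSndFDerivAt (by simp)).eq _ _
  simp only [vectorSpaceBracket_eq_neg_fderiv_sharp skew₁,
    vectorSpaceBracket_eq_neg_fderiv_sharp skew₂, cyclicSharpDeriv,
    fderiv_vectorSpaceBracket hP₁ hf hg, fderiv_vectorSpaceBracket hP₁ hg hh,
    fderiv_vectorSpaceBracket hP₁ hh hf, fderiv_vectorSpaceBracket hP₂ hf hg,
    fderiv_vectorSpaceBracket hP₂ hg hh, fderiv_vectorSpaceBracket hP₂ hh hf]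
  rw [skew₁ (fderiv ℝ (fderiv ℝ f) z _), skew₁ (fderiv ℝ (fderiv ℝ g) z _),
    skew₁ (fderiv ℝ (fderiv ℝ h) z _), skew₂ (fderiv ℝ (fderiv ℝ f) z _),
    skew₂ (fderiv ℝ (fderiv ℝ g) z _), skew₂ (fderiv ℝ (fderiv ℝ h) z _)]
  simp only [← apply_sharp_eq]
  linarith [snd_symm hf (fderiv ℝ g z) (fderiv ℝ h z), snd_symm hf (fderiv ℝ h z) (fderiv ℝ g z),
    snd_symm hg (fderiv ℝ f z) (fderiv ℝ h z), snd_symm hg (fderiv ℝ h z) (fderiv ℝ f z),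
    snd_symm hh (fderiv ℝ f z) (fderiv ℝ g z), snd_symm hh (fderiv ℝ g z) (fderiv ℝ f z)]

end VectorSpace

section CanonicalCoordinates

variable {E : Type*} [NormedAddCommGroup E] [NormedSpace ℝ E]

variable (E) in
/-- The space of canonical coordinates `(x, p)` of the cotangent bundle. -/
abbrev PhaseSpace : Type _ := E × StrongDual ℝ E

/-- The horizontal lift `v ↦ (v, p(G(x)(·, v)))` at `z = (x, p)` for the Christoffel symbols `G`.
Here and below `G x b v` is the derivative of the constant vector field `b` in the direction `v`. -/
def coordHorizontalLift (G : E → E →L[ℝ] E →L[ℝ] E) (z : PhaseSpace E) : E →L[ℝ] PhaseSpace E :=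
  ContinuousLinearMap.inl ℝ E (StrongDual ℝ E) + (ContinuousLinearMap.inr ℝ E (StrongDual ℝ E)).comp
    ((ContinuousLinearMap.compL ℝ E E ℝ z.2).comp (G z.1).flip)

theorem coordHorizontalLift_apply (G : E → E →L[ℝ] E →L[ℝ] E) (z : PhaseSpace E) (v : E) :
    coordHorizontalLift G z v = (v, z.2.comp ((G z.1).flip v)) := by
  simp [coordHorizontalLift]

/-- The horizontal lift `w^H` in canonical coordinates: `(Φ, Ψ) ↦ W(Φ ∘ h, Ψ ∘ h)` with `h` the
horizontal lift of vectors. -/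
def coordLiftTensor (W : E → DualBilinForm E) (G : E → E →L[ℝ] E →L[ℝ] E) (z : PhaseSpace E) :
    DualBilinForm (PhaseSpace E) :=
  (ContinuousLinearMap.precomp ℝ (ContinuousLinearMap.precomp ℝ (coordHorizontalLift G z))).comp
    ((W z.1).comp (ContinuousLinearMap.precomp ℝ (coordHorizontalLift G z)))

variable (E) in
/-- The canonical Poisson tensor `W_0` in canonical coordinates. -/
def coordCanonicalPoisson : DualBilinForm (PhaseSpace E) :=
  let A : DualBilinForm (PhaseSpace E) :=
    (ContinuousLinearMap.precomp ℝ
      (ContinuousLinearMap.precomp ℝ (ContinuousLinearMap.inl ℝ E (StrongDual ℝ E)))).comp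
      (ContinuousLinearMap.precomp ℝ (ContinuousLinearMap.inr ℝ E (StrongDual ℝ E)))
  A - A.flip

/-- The curvature `R(u, v) a` in coordinates. -/
def christoffelCurvature (G : E → E →L[ℝ] E →L[ℝ] E) (x u v a : E) : E :=
  fderiv ℝ G x u a v - fderiv ℝ G x v a u + G x (G x a v) u - G x (G x a u) v

variable {W : E → DualBilinForm E} {G : E → E →L[ℝ] E →L[ℝ] E} {x : E} {z : PhaseSpace E}

theorem comp_fst_comp_coordHorizontalLift (G : E → E →L[ℝ] E →L[ℝ] E) (z : PhaseSpace E)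
    (α : StrongDual ℝ E) :
    (α.comp (ContinuousLinearMap.fst ℝ E (StrongDual ℝ E))).comp (coordHorizontalLift G z) = α := by
  ext v
  simp [coordHorizontalLift_apply]

theorem coordLiftTensor_apply (W : E → DualBilinForm E) (G : E → E →L[ℝ] E →L[ℝ] E)
    (z : PhaseSpace E) (Φ Ψ : StrongDual ℝ (PhaseSpace E)) :
    coordLiftTensor W G z Φ Ψ =
      W z.1 (Φ.comp (coordHorizontalLift G z)) (Ψ.comp (coordHorizontalLift G z)) := rfl

theorem coordCanonicalPoisson_apply (Φ Ψ : StrongDual ℝ (PhaseSpace E)) :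
    coordCanonicalPoisson E Φ Ψ =
      Φ (0, Ψ.comp (ContinuousLinearMap.inl ℝ E (StrongDual ℝ E))) -
        Ψ (0, Φ.comp (ContinuousLinearMap.inl ℝ E (StrongDual ℝ E))) := rfl

theorem coordCanonicalPoisson_skew (Φ Ψ : StrongDual ℝ (PhaseSpace E)) :
    coordCanonicalPoisson E Φ Ψ = -coordCanonicalPoisson E Ψ Φ :=
  (neg_sub _ _).symm

theorem christoffelCurvature_zero (G : E → E →L[ℝ] E →L[ℝ] E) (x u v : E) :
    christoffelCurvature G x u v 0 = 0 := by
  simp [christoffelCurvature]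

theorem contDiffAt_coordHorizontalLift {n : WithTop ℕ∞} (hG : ContDiffAt ℝ n G z.1) :
    ContDiffAt ℝ n (coordHorizontalLift G) z := by
  have hGz : ContDiffAt ℝ n (fun y : PhaseSpace E ↦ (G y.1).flip) z :=
    (ContinuousLinearMap.flipₗᵢ ℝ E E E).contDiff.contDiffAt.comp z (hG.comp z contDiffAt_fst)
  have hp : ContDiffAt ℝ n (fun y : PhaseSpace E ↦ ContinuousLinearMap.compL ℝ E E ℝ y.2) z :=
    (ContinuousLinearMap.contDiff _).contDiffAt.comp z contDiffAt_snd
  exact contDiffAt_const.add (contDiffAt_const.clm_comp (hp.clm_comp hGz))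

theorem contDiffAt_coordLiftTensor {n : WithTop ℕ∞} (hW : ContDiffAt ℝ n W z.1)
    (hG : ContDiffAt ℝ n G z.1) : ContDiffAt ℝ n (coordLiftTensor W G) z := by
  have contDiffAt_precomp {F₁ F₂ : Type _} [NormedAddCommGroup F₁] [NormedSpace ℝ F₁]
      [NormedAddCommGroup F₂] [NormedSpace ℝ F₂] {L : PhaseSpace E → F₁ →L[ℝ] F₂}
      (hL : ContDiffAt ℝ n L z) : ContDiffAt ℝ n (fun y ↦ ContinuousLinearMap.precomp ℝ (L y)) z :=
    (ContinuousLinearMap.compL ℝ F₁ F₂ ℝ).flip.contDiff.contDiffAt.comp z hL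
  have hprecomp := contDiffAt_precomp (contDiffAt_coordHorizontalLift hG)
  have hWz : ContDiffAt ℝ n (fun y : PhaseSpace E ↦ W y.1) z := hW.comp z contDiffAt_fst
  exact (contDiffAt_precomp hprecomp).clm_comp (hWz.clm_comp hprecomp)

theorem fderiv_coordHorizontalLift (hG : DifferentiableAt ℝ G z.1) (u : PhaseSpace E) (v : E) :
    fderiv ℝ (coordHorizontalLift G) z u v =
      (0, u.2.comp ((G z.1).flip v) + z.2.comp ((fderiv ℝ G z.1 u.1).flip v)) := by
  have hGz : HasFDerivAt (fun y : PhaseSpace E ↦ (G y.1).flip) _ z :=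
    ((ContinuousLinearMap.flipₗᵢ ℝ E E E).toContinuousLinearEquiv.hasFDerivAt).comp z
      (hG.hasFDerivAt.comp z hasFDerivAt_fst)
  have hp : HasFDerivAt (fun y : PhaseSpace E ↦ ContinuousLinearMap.compL ℝ E E ℝ y.2) _ z :=
    (ContinuousLinearMap.hasFDerivAt _).comp z hasFDerivAt_snd
  have hlift : HasFDerivAt (coordHorizontalLift G) _ z :=
    (hasFDerivAt_const _ z).add ((hasFDerivAt_const _ z).clm_comp (hp.clm_comp hGz))
  rw [hlift.fderiv]
  ext <;> simp [add_comm]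

theorem fderiv_coordLiftTensor (hW : ContDiffAt ℝ 1 W z.1) (hG : ContDiffAt ℝ 1 G z.1)
    (Φ Ψ : StrongDual ℝ (PhaseSpace E)) (u : PhaseSpace E) :
    fderiv ℝ (coordLiftTensor W G) z u Φ Ψ =
      fderiv ℝ W z.1 u.1 (Φ.comp (coordHorizontalLift G z)) (Ψ.comp (coordHorizontalLift G z))
      + W z.1 (Φ.comp (fderiv ℝ (coordHorizontalLift G) z u)) (Ψ.comp (coordHorizontalLift G z))
      + W z.1 (Φ.comp (coordHorizontalLift G z))
          (Ψ.comp (fderiv ℝ (coordHorizontalLift G) z u)) := by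
  have hlift := ((contDiffAt_coordHorizontalLift hG).differentiableAt (by simp)).hasFDerivAt
  have hcomp (Ξ : StrongDual ℝ (PhaseSpace E)) :
      HasFDerivAt (fun y ↦ Ξ.comp (coordHorizontalLift G y)) _ z :=
    (hasFDerivAt_const Ξ z).clm_comp hlift
  have hWz : HasFDerivAt (fun y : PhaseSpace E ↦ W y.1) _ z :=
    (hW.differentiableAt (by simp)).hasFDerivAt.comp z hasFDerivAt_fst
  rw [fderiv_apply_apply ((contDiffAt_coordLiftTensor hW hG).differentiableAt (by simp))]
  simp only [coordLiftTensor_apply]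
  rw [((hWz.clm_apply (hcomp Φ)).clm_apply (hcomp Ψ)).fderiv]
  simp only [add_apply, ContinuousLinearMap.comp_apply, ContinuousLinearMap.flip_apply,
    ContinuousLinearMap.compL_apply, ContinuousLinearMap.comp_zero, add_zero,
    ContinuousLinearMap.coe_fst']
  ring

/-- `W` is a skew field, smooth at `x`, that is parallel at `x` for the torsion-free connection with
Christoffel symbols `G`; the coordinate form of `IsPoissonConnection`. -/
structure IsPoissonChristoffel (W : E → DualBilinForm E) (G : E → E →L[ℝ] E →L[ℝ] E) (x : E) :
    Prop where
  contDiffAt_bivector : ContDiffAt ℝ ∞ W x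
  contDiffAt_christoffel : ContDiffAt ℝ ∞ G x
  skew : ∀ α β, W x α β = -W x β α
  symm : ∀ᶠ y in 𝓝 x, ∀ u v, G y u v = G y v u
  parallel : ∀ (t : E) (α β : StrongDual ℝ E), fderiv ℝ W x t α β =
    -W x (α.comp ((G x).flip t)) β - W x α (β.comp ((G x).flip t))

namespace IsPoissonChristoffel

theorem symm_self (h : IsPoissonChristoffel W G x) (u v : E) : G x u v = G x v u :=
  h.symm.self_of_nhds u v

theorem fderiv_symm (h : IsPoissonChristoffel W G x) (t u v : E) :
    fderiv ℝ G x t u v = fderiv ℝ G x t v u := by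
  have hG : DifferentiableAt ℝ G x := h.contDiffAt_christoffel.differentiableAt (by simp)
  have hsymm : (fun y ↦ G y u v) =ᶠ[𝓝 x] fun y ↦ G y v u := h.symm.mono fun y hy ↦ hy u v
  rw [fderiv_apply_apply hG, fderiv_apply_apply hG, hsymm.fderiv_eq]

theorem bianchi (h : IsPoissonChristoffel W G x) (u v a : E) :
    christoffelCurvature G x u v a + christoffelCurvature G x v a u
      + christoffelCurvature G x a u v = 0 := by
  simp only [christoffelCurvature]
  rw [h.fderiv_symm u a v, h.fderiv_symm v a u, h.fderiv_symm a u v, h.symm_self a v,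
    h.symm_self a u, h.symm_self u v]
  abel

end IsPoissonChristoffel

variable [FiniteDimensional ℝ E]

/-- The vertical part `Φ(0, ·)` of a covector of the phase space, as a vector of `E`. -/
def verticalPart (Φ : StrongDual ℝ (PhaseSpace E)) : E :=
  bidualInv E (Φ.comp (ContinuousLinearMap.inr ℝ E (StrongDual ℝ E)))

theorem apply_verticalPart (Φ : StrongDual ℝ (PhaseSpace E)) (q : StrongDual ℝ E) :
    q (verticalPart Φ) = Φ (0, q) :=
  apply_bidualInv _ q

theorem apply_coordHorizontalLift (G : E → E →L[ℝ] E →L[ℝ] E) (z : PhaseSpace E)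
    (Φ : StrongDual ℝ (PhaseSpace E)) (v : E) :
    Φ (coordHorizontalLift G z v) = Φ (v, 0) + z.2 (G z.1 (verticalPart Φ) v) := by
  have hvert : z.2 (G z.1 (verticalPart Φ) v) = Φ (0, z.2.comp ((G z.1).flip v)) :=
    apply_verticalPart Φ (z.2.comp ((G z.1).flip v))
  rw [coordHorizontalLift_apply, hvert, ← map_add, Prod.mk_add_mk, add_zero, zero_add]

theorem sharp_coordLiftTensor (W : E → DualBilinForm E) (G : E → E →L[ℝ] E →L[ℝ] E)
    (z : PhaseSpace E) (Φ : StrongDual ℝ (PhaseSpace E)) :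
    sharp (coordLiftTensor W G z) Φ =
      coordHorizontalLift G z (sharp (W z.1) (Φ.comp (coordHorizontalLift G z))) :=
  sharp_eq_iff.mpr fun _ ↦ (apply_sharp_eq (W z.1) _ _).symm

theorem sharp_coordCanonicalPoisson (Φ : StrongDual ℝ (PhaseSpace E)) :
    sharp (coordCanonicalPoisson E) Φ =
      (verticalPart Φ, -Φ.comp (ContinuousLinearMap.inl ℝ E (StrongDual ℝ E))) := by
  refine sharp_eq_iff.mpr fun Ψ ↦ ?_
  rw [coordCanonicalPoisson_apply, ← apply_verticalPart, ContinuousLinearMap.comp_apply,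
    ContinuousLinearMap.inl_apply, ← map_sub, Prod.mk_sub_mk, sub_zero, zero_sub]

theorem cyclicSharpDeriv_const_coordCanonicalPoisson (B : DualBilinForm (PhaseSpace E))
    (Φ Ψ Θ : StrongDual ℝ (PhaseSpace E)) :
    cyclicSharpDeriv (fun _ ↦ coordCanonicalPoisson E) B z Φ Ψ Θ = 0 := by
  simp only [cyclicSharpDeriv, fderiv_const_apply, zero_apply, add_zero]

theorem exists_verticalPart_eq_comp_coordHorizontalLift_eq_zero (G : E → E →L[ℝ] E →L[ℝ] E)
    (z : PhaseSpace E) (b : E) : ∃ Ψ : StrongDual ℝ (PhaseSpace E),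
      verticalPart Ψ = b ∧ Ψ.comp (coordHorizontalLift G z) = 0 := by
  set Ψ : StrongDual ℝ (PhaseSpace E) :=
    (ContinuousLinearMap.apply ℝ ℝ b).comp (ContinuousLinearMap.snd ℝ E (StrongDual ℝ E))
      - (z.2.comp (G z.1 b)).comp (ContinuousLinearMap.fst ℝ E (StrongDual ℝ E)) with hΨ
  have hvert : verticalPart Ψ = b := by
    refine (SeparatingDual.eq_iff_forall_dual_eq (R := ℝ)).mpr fun q ↦ ?_
    simp [apply_verticalPart, hΨ]
  refine ⟨Ψ, hvert, ?_⟩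
  ext v
  rw [ContinuousLinearMap.comp_apply, apply_coordHorizontalLift, hvert]
  simp [hΨ]

theorem verticalPart_comp_fst (α : StrongDual ℝ E) :
    verticalPart (α.comp (ContinuousLinearMap.fst ℝ E (StrongDual ℝ E))) = 0 := by
  refine (SeparatingDual.eq_iff_forall_dual_eq (R := ℝ)).mpr fun q ↦ ?_
  simp [apply_verticalPart]

namespace IsPoissonChristoffel

theorem fderiv_coordLiftTensor_apply (h : IsPoissonChristoffel W G x) (p : StrongDual ℝ E)
    (Φ Ψ : StrongDual ℝ (PhaseSpace E)) (t : E) (q : StrongDual ℝ E) {a b r s : E}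
    (ha : verticalPart Φ = a) (hb : verticalPart Ψ = b)
    (hr : sharp (W x) (Φ.comp (coordHorizontalLift G (x, p))) = r)
    (hs : sharp (W x) (Ψ.comp (coordHorizontalLift G (x, p))) = s) :
    fderiv ℝ (coordLiftTensor W G) (x, p) (t, q) Φ Ψ =
      Φ (coordHorizontalLift G (x, p) (G x s t)) - Ψ (coordHorizontalLift G (x, p) (G x r t))
        - (q (G x a s) + p (fderiv ℝ G x t a s)) + (q (G x b r) + p (fderiv ℝ G x t b r)) := by
  have hG : ContDiffAt ℝ 1 G x := h.contDiffAt_christoffel.of_le (by norm_cast)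
  have vertical (Ξ : StrongDual ℝ (PhaseSpace E)) (v : E) :
      Ξ (fderiv ℝ (coordHorizontalLift G) (x, p) (t, q) v) =
        q (G x (verticalPart Ξ) v) + p (fderiv ℝ G x t (verticalPart Ξ) v) := by
    rw [fderiv_coordHorizontalLift (hG.differentiableAt (by simp)), ← apply_verticalPart]
    rfl
  rw [fderiv_coordLiftTensor (h.contDiffAt_bivector.of_le (by norm_cast)) hG, h.parallel,
    h.skew (ContinuousLinearMap.comp _ (ContinuousLinearMap.flip _ _)),
    h.skew (Φ.comp (fderiv ℝ _ _ _))]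
  simp only [← apply_sharp_eq, hr, hs, ContinuousLinearMap.comp_apply,
    ContinuousLinearMap.flip_apply, vertical, ha, hb]
  ring

theorem cyclicSharpDeriv_coordLiftTensor_self (h : IsPoissonChristoffel W G x) (p : StrongDual ℝ E)
    (Φ Ψ Θ : StrongDual ℝ (PhaseSpace E)) {r s t a b c : E}
    (ha : verticalPart Φ = a) (hb : verticalPart Ψ = b) (hc : verticalPart Θ = c)
    (hr : sharp (W x) (Φ.comp (coordHorizontalLift G (x, p))) = r)
    (hs : sharp (W x) (Ψ.comp (coordHorizontalLift G (x, p))) = s)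
    (ht : sharp (W x) (Θ.comp (coordHorizontalLift G (x, p))) = t) :
    cyclicSharpDeriv (coordLiftTensor W G) (coordLiftTensor W G (x, p)) (x, p) Φ Ψ Θ =
      p (christoffelCurvature G x s t a + christoffelCurvature G x t r b
        + christoffelCurvature G x r s c) := by
  simp only [cyclicSharpDeriv, sharp_coordLiftTensor, hr, hs, ht, coordHorizontalLift_apply]
  rw [h.fderiv_coordLiftTensor_apply p Φ Ψ _ _ ha hb hr hs,
    h.fderiv_coordLiftTensor_apply p Ψ Θ _ _ hb hc hs ht,
    h.fderiv_coordLiftTensor_apply p Θ Φ _ _ hc ha ht hr]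
  simp only [christoffelCurvature, map_add, map_sub, ContinuousLinearMap.comp_apply,
    ContinuousLinearMap.flip_apply]
  rw [h.symm_self s t, h.symm_self r t, h.symm_self r s]
  ring

theorem cyclicSharpDeriv_coordLiftTensor_coordCanonicalPoisson (h : IsPoissonChristoffel W G x)
    (p : StrongDual ℝ E) (Φ Ψ Θ : StrongDual ℝ (PhaseSpace E)) {r s t a b c : E}
    (ha : verticalPart Φ = a) (hb : verticalPart Ψ = b) (hc : verticalPart Θ = c)
    (hr : sharp (W x) (Φ.comp (coordHorizontalLift G (x, p))) = r)
    (hs : sharp (W x) (Ψ.comp (coordHorizontalLift G (x, p))) = s)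
    (ht : sharp (W x) (Θ.comp (coordHorizontalLift G (x, p))) = t) :
    cyclicSharpDeriv (coordLiftTensor W G) (coordCanonicalPoisson E) (x, p) Φ Ψ Θ =
      -p (christoffelCurvature G x b c r + christoffelCurvature G x c a s
        + christoffelCurvature G x a b t) := by
  simp only [cyclicSharpDeriv, sharp_coordCanonicalPoisson, ha, hb, hc]
  rw [h.fderiv_coordLiftTensor_apply p Φ Ψ _ _ ha hb hr hs,
    h.fderiv_coordLiftTensor_apply p Ψ Θ _ _ hb hc hs ht,
    h.fderiv_coordLiftTensor_apply p Θ Φ _ _ hc ha ht hr]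
  simp only [apply_coordHorizontalLift, ha, hb, hc, christoffelCurvature, map_add, map_sub,
    neg_apply, ContinuousLinearMap.comp_apply, ContinuousLinearMap.inl_apply]
  rw [h.fderiv_symm c a s, h.fderiv_symm c b r, h.fderiv_symm a b t, h.fderiv_symm a c s,
    h.fderiv_symm b c r, h.fderiv_symm b a t]
  rw [h.symm_self a s, h.symm_self b r, h.symm_self b t, h.symm_self c s, h.symm_self c r,
    h.symm_self a t, h.symm_self c (G x s a), h.symm_self c (G x r b), h.symm_self a (G x t b),
    h.symm_self a (G x s c), h.symm_self b (G x r c), h.symm_self b (G x t a)]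
  ring

theorem cyclicSharpDeriv_coordLiftTensor_self_eq_zero (h : IsPoissonChristoffel W G x)
    (hflat : ∀ (u v : E) (α : StrongDual ℝ E), christoffelCurvature G x u v (sharp (W x) α) = 0)
    (p : StrongDual ℝ E) (Φ Ψ Θ : StrongDual ℝ (PhaseSpace E)) :
    cyclicSharpDeriv (coordLiftTensor W G) (coordLiftTensor W G (x, p)) (x, p) Φ Ψ Θ = 0 := by
  have hsharp (α β : StrongDual ℝ E) (a : E) :
      christoffelCurvature G x (sharp (W x) α) (sharp (W x) β) a = 0 := by
    simpa only [hflat, add_zero] using h.bianchi (sharp (W x) α) (sharp (W x) β) a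
  rw [h.cyclicSharpDeriv_coordLiftTensor_self p Φ Ψ Θ rfl rfl rfl rfl rfl rfl]
  simp only [hsharp, add_zero, map_zero]

theorem forall_cyclicSharpDeriv_coordCanonicalPoisson_eq_zero_iff
    (h : IsPoissonChristoffel W G x) :
    (∀ (p : StrongDual ℝ E) (Φ Ψ Θ : StrongDual ℝ (PhaseSpace E)),
      cyclicSharpDeriv (coordLiftTensor W G) (coordCanonicalPoisson E) (x, p) Φ Ψ Θ = 0) ↔
    ∀ (u v : E) (α : StrongDual ℝ E), christoffelCurvature G x u v (sharp (W x) α) = 0 := by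
  refine ⟨fun hcyc u v α ↦ ?_, fun hflat p Φ Ψ Θ ↦ ?_⟩
  · refine (SeparatingDual.eq_iff_forall_dual_eq (R := ℝ)).mpr fun p ↦ ?_
    -- `α ∘ fst` sees only the base; `Ψ` and `Θ` see only the fibre.
    obtain ⟨Ψ, hu, hΨ⟩ := exists_verticalPart_eq_comp_coordHorizontalLift_eq_zero G (x, p) u
    obtain ⟨Θ, hv, hΘ⟩ := exists_verticalPart_eq_comp_coordHorizontalLift_eq_zero G (x, p) v
    have hsum := h.cyclicSharpDeriv_coordLiftTensor_coordCanonicalPoisson p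
      (α.comp (ContinuousLinearMap.fst ℝ E (StrongDual ℝ E))) Ψ Θ (verticalPart_comp_fst α) hu hv
      (congrArg _ (comp_fst_comp_coordHorizontalLift G (x, p) α)) rfl rfl
    have hzero : sharp (W x) 0 = 0 := by simp [sharp]
    simpa [hcyc, hΨ, hΘ, hzero, christoffelCurvature_zero] using hsum
  · rw [h.cyclicSharpDeriv_coordLiftTensor_coordCanonicalPoisson p Φ Ψ Θ rfl rfl rfl rfl rfl rfl]
    simp only [hflat, add_zero, map_zero, neg_zero]

end IsPoissonChristoffel

end CanonicalCoordinates

section ChartCoordinates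

theorem contDiffAt_of_clm_apply {D F G : Type*} [NormedAddCommGroup D] [NormedSpace ℝ D]
    [NormedAddCommGroup F] [NormedSpace ℝ F] [FiniteDimensional ℝ F]
    [NormedAddCommGroup G] [NormedSpace ℝ G] {n : WithTop ℕ∞} {f : D → F →L[ℝ] G} {x : D}
    (h : ∀ y, ContDiffAt ℝ n (fun z ↦ f z y) x) : ContDiffAt ℝ n f x := by
  let d := Module.finrank ℝ F
  have hd : d = Module.finrank ℝ (Fin d → ℝ) := (Module.finrank_fin_fun ℝ).symm
  let e₁ := ContinuousLinearEquiv.ofFinrankEq hd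
  let e₂ := (e₁.arrowCongr (1 : G ≃L[ℝ] G)).trans (ContinuousLinearEquiv.piRing (Fin d))
  rw [← Function.id_comp f, ← e₂.symm_comp_self]
  exact e₂.symm.contDiff.contDiffAt.comp x (contDiffAt_pi.mpr fun i ↦ h _)

variable {F : Type*} [NormedAddCommGroup F] [NormedSpace ℝ F]
  {H : Type*} [TopologicalSpace H] {J : ModelWithCorners ℝ F H}
  {N : Type*} [TopologicalSpace N] [ChartedSpace H N] {x y : N}

theorem eventuallyEq_comp_extChartAt (hy : y ∈ (chartAt H x).source) {S : Type*} (f : N → S) :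
    f =ᶠ[𝓝 y] fun z ↦ (f ∘ (extChartAt J x).symm) (extChartAt J x z) := by
  filter_upwards [(chartAt H x).open_source.mem_nhds hy] with z hz
  simp [hz]

variable [IsManifold J ∞ N]

section

variable (J)

/-- The derivative at `y` of the preferred chart at `x`, with junk value `0` if `y` is not in its
source. -/
abbrev chartDeriv (x y : N) : TangentSpace J y →L[ℝ] F :=
  (trivializationAt F (TangentSpace J) x).continuousLinearMapAt ℝ y

/-- The inverse of `chartDeriv J x y`. -/
abbrev chartDerivSymm (x y : N) : F →L[ℝ] TangentSpace J y :=
  (trivializationAt F (TangentSpace J) x).symmL ℝ y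

/-- The 1-form near `x` with constant coefficients `α` in the preferred chart at `x`. -/
def chartForm (x : N) (α : StrongDual ℝ F) (y : N) : TangentSpace J y →L[ℝ] ℝ :=
  α.comp (chartDeriv J x y)

end

theorem chartDerivSymm_chartDeriv (hy : y ∈ (chartAt H x).source) (v : TangentSpace J y) :
    chartDerivSymm J x y (chartDeriv J x y v) = v :=
  (trivializationAt F (TangentSpace J) x).symmL_continuousLinearMapAt (by simpa using hy) v

theorem chartDeriv_chartDerivSymm (hy : y ∈ (chartAt H x).source) (b : F) :
    chartDeriv J x y (chartDerivSymm J x y b) = b :=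
  (trivializationAt F (TangentSpace J) x).continuousLinearMapAt_symmL (by simpa using hy) b

theorem smoothOneFormAt_chartForm (α : StrongDual ℝ F) (hy : y ∈ (chartAt H x).source) :
    SmoothOneFormAt (J := J) (chartForm J x α) y := by
  unfold SmoothOneFormAt
  rw [Bundle.Trivialization.contMDiffAt_section_iff
    (trivializationAt (StrongDual ℝ F) (fun y : N ↦ TangentSpace J y →L[ℝ] ℝ) x)
    (by simpa using hy)]
  refine (contMDiffAt_const (c := α)).congr_of_eventuallyEq ?_
  filter_upwards [(chartAt H x).open_source.mem_nhds hy] with z hz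
  ext v
  have := chartDeriv_chartDerivSymm (J := J) hz v
  simp only [hom_trivializationAt_apply, ContinuousLinearMap.inCoordinates, chartForm,
    ContinuousLinearMap.comp_apply, this]
  simp

theorem SmoothOneFormAt.contMDiffAt_coord {β : ∀ y : N, TangentSpace J y →L[ℝ] ℝ}
    (hβ : SmoothOneFormAt β x) :
    ContMDiffAt J 𝓘(ℝ, StrongDual ℝ F) ∞
      (fun y ↦ ((β y).comp (chartDerivSymm J x y) : StrongDual ℝ F)) x := by
  have := ((contMDiffAt_hom_bundle _).1 hβ).2
  refine this.congr_of_eventuallyEq (Filter.Eventually.of_forall fun y ↦ ?_)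
  ext v
  simp [ContinuousLinearMap.inCoordinates]

theorem chartForm_coord (hy : y ∈ (chartAt H x).source) (β : TangentSpace J y →L[ℝ] ℝ) :
    chartForm J x (β.comp (chartDerivSymm J x y)) y = β := by
  ext v
  exact congrArg β (chartDerivSymm_chartDeriv hy v)

variable {G : Type*} [NormedAddCommGroup G] [NormedSpace ℝ G]

theorem hasMFDerivAt_comp_extChartAt (hy : y ∈ (chartAt H x).source) {g : F → G}
    {g' : F →L[ℝ] G} (hg : HasFDerivAt g g' (extChartAt J x y)) :
    HasMFDerivAt J 𝓘(ℝ, G) (fun z ↦ g (extChartAt J x z)) y (g'.comp (chartDeriv J x y)) := by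
  have hasMFDerivAt_chart : HasMFDerivAt J 𝓘(ℝ, F) (extChartAt J x) y (chartDeriv J x y) := by
    have hderiv := (mdifferentiableAt_extChartAt (I := J) hy).hasMFDerivAt
    rwa [← TangentBundle.continuousLinearMapAt_trivializationAt hy] at hderiv
  exact hg.hasMFDerivAt.comp y hasMFDerivAt_chart

theorem mvfderiv_apply_of_eventuallyEq_comp_extChartAt (hy : y ∈ (chartAt H x).source) {g : F → G}
    {g' : F →L[ℝ] G} (hg : HasFDerivAt g g' (extChartAt J x y)) {f : N → G}
    (h : ∀ᶠ z in 𝓝 y, f z = g (extChartAt J x z)) (v : TangentSpace J y) :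
    mvfderiv J f y v = g' (chartDeriv J x y v) :=
  DFunLike.congr_fun ((hasMFDerivAt_comp_extChartAt hy hg).congr_of_eventuallyEq h).mfderiv v

theorem contMDiffAt_comp_extChartAt {n : WithTop ℕ∞} (hn : n ≤ ∞)
    (hy : y ∈ (chartAt H x).source) {g : F → G} (hg : ContDiffAt ℝ n g (extChartAt J x y)) :
    ContMDiffAt J 𝓘(ℝ, G) n (fun z ↦ g (extChartAt J x z)) y :=
  hg.contMDiffAt.comp y ((contMDiffAt_extChartAt' (n := ∞) hy).of_le hn)

variable [J.Boundaryless]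

theorem contMDiffAt_extChartAt_symm (hy : y ∈ (chartAt H x).source) :
    ContMDiffAt 𝓘(ℝ, F) J ∞ (extChartAt J x).symm (extChartAt J x y) :=
  (contMDiffOn_extChartAt_symm x).contMDiffAt ((isOpen_extChartAt_target x).mem_nhds
    ((extChartAt J x).map_source (by simpa using hy)))

theorem contDiffAt_comp_extChartAt_symm {n : WithTop ℕ∞} (hn : n ≤ ∞)
    (hy : y ∈ (chartAt H x).source) {f : N → G} (hf : ContMDiffAt J 𝓘(ℝ, G) n f y) :
    ContDiffAt ℝ n (f ∘ (extChartAt J x).symm) (extChartAt J x y) :=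
  (hf.comp_of_eq ((contMDiffAt_extChartAt_symm hy).of_le hn) (by simp [hy])).contDiffAt

theorem differentiableAt_comp_extChartAt_symm
    (hy : y ∈ (chartAt H x).source) {f : N → G} (hf : MDifferentiableAt J 𝓘(ℝ, G) f y) :
    DifferentiableAt ℝ (f ∘ (extChartAt J x).symm) (extChartAt J x y) :=
  (MDifferentiableAt.comp_of_eq (hg := hf)
    (hf := (contMDiffAt_extChartAt_symm hy).mdifferentiableAt (by simp))
    (hy := by simp [hy])).differentiableAt

theorem mvfderiv_eq_fderiv (hy : y ∈ (chartAt H x).source) {f : N → G}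
    (hf : MDifferentiableAt J 𝓘(ℝ, G) f y) :
    mvfderiv J f y =
      (fderiv ℝ (f ∘ (extChartAt J x).symm) (extChartAt J x y)).comp (chartDeriv J x y) :=
  ((hasMFDerivAt_comp_extChartAt hy
    (differentiableAt_comp_extChartAt_symm hy hf).hasFDerivAt).congr_of_eventuallyEq
      (eventuallyEq_comp_extChartAt hy f)).mfderiv

/-- `Q` is the local expression of the contravariant tensor `P` in the preferred chart at `x`. -/
def HasChartExpression (P : ContravariantTwoTensor J N) (x : N)
    (Q : F → DualBilinForm F) : Prop :=
  ∀ y ∈ (chartAt H x).source, ∀ Φ Ψ : StrongDual ℝ F,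
    P y (chartForm J x Φ y) (chartForm J x Ψ y) = Q (extChartAt J x y) Φ Ψ

end ChartCoordinates

section CoordinateCovariantDerivative

variable {E : Type*} [NormedAddCommGroup E] [NormedSpace ℝ E]

/-- The covariant derivative of the vector field `Z` along `V` on a vector space, for the
connection with Christoffel symbol `G`. -/
def coordCovDeriv (G : E → E →L[ℝ] E →L[ℝ] E) (Z V : E → E) (z : E) : E :=
  fderiv ℝ Z z (V z) + G z (Z z) (V z)

variable {G : E → E →L[ℝ] E →L[ℝ] E} {X Y Z : E → E} {c : E}

theorem hasFDerivAt_coordCovDeriv (hG : DifferentiableAt ℝ G c)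
    (hX : DifferentiableAt ℝ X c) (hZ : ContDiffAt ℝ 2 Z c) :
    HasFDerivAt (coordCovDeriv G Z X)
      ((fderiv ℝ Z c).comp (fderiv ℝ X c) + (fderiv ℝ (fderiv ℝ Z) c).flip (X c)
        + ((G c (Z c)).comp (fderiv ℝ X c)
          + ((G c).comp (fderiv ℝ Z c) + (fderiv ℝ G c).flip (Z c)).flip (X c))) c := by
  have hdZ : DifferentiableAt ℝ (fderiv ℝ Z) c :=
    (hZ.fderiv_right (m := 1) (by norm_num)).differentiableAt (by simp)
  exact (hdZ.hasFDerivAt.clm_apply hX.hasFDerivAt).add ((hG.hasFDerivAt.clm_apply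
    (hZ.differentiableAt (by simp)).hasFDerivAt).clm_apply hX.hasFDerivAt)

theorem coordCovDeriv_coordCovDeriv (hG : DifferentiableAt ℝ G c)
    (hX : DifferentiableAt ℝ X c) (hZ : ContDiffAt ℝ 2 Z c) (Y : E → E) :
    coordCovDeriv G (coordCovDeriv G Z X) Y c =
      fderiv ℝ (fderiv ℝ Z) c (Y c) (X c) + fderiv ℝ Z c (fderiv ℝ X c (Y c))
        + (fderiv ℝ G c (Y c) (Z c) (X c) + G c (fderiv ℝ Z c (Y c)) (X c)
          + G c (Z c) (fderiv ℝ X c (Y c)))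
        + G c (fderiv ℝ Z c (X c) + G c (Z c) (X c)) (Y c) := by
  rw [coordCovDeriv, (hasFDerivAt_coordCovDeriv hG hX hZ).fderiv]
  simp only [coordCovDeriv, add_apply, ContinuousLinearMap.comp_apply,
    ContinuousLinearMap.flip_apply]
  abel

theorem coordCovDeriv_comm_sub_eq_christoffelCurvature (hG : DifferentiableAt ℝ G c)
    (symm : ∀ u v, G c u v = G c v u) (hX : DifferentiableAt ℝ X c) (hY : DifferentiableAt ℝ Y c)
    (hZ : ContDiffAt ℝ 2 Z c) :
    coordCovDeriv G (coordCovDeriv G Z Y) X c - coordCovDeriv G (coordCovDeriv G Z X) Y c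
        - coordCovDeriv G Z (coordCovDeriv G Y X - coordCovDeriv G X Y) c =
      christoffelCurvature G c (X c) (Y c) (Z c) := by
  have hsymm := (hZ.isSymmSndFDerivAt (by simp)).eq (X c) (Y c)
  rw [coordCovDeriv_coordCovDeriv hG hY hZ, coordCovDeriv_coordCovDeriv hG hX hZ]
  simp only [coordCovDeriv, christoffelCurvature, Pi.sub_apply, map_add, map_sub, add_apply, hsymm,
    symm (Y c) (X c)]
  abel

end CoordinateCovariantDerivative

section ConnectionInChart

variable {E : Type*} [NormedAddCommGroup E] [NormedSpace ℝ E]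
  {M : Type*} [TopologicalSpace M] [ChartedSpace E M] [IsManifold 𝓘(ℝ, E) ∞ M]

/-- The vector field near `x` with constant coefficients `b` in the preferred chart at `x`. -/
def coordField (x : M) (b : E) (y : M) : TangentSpace 𝓘(ℝ, E) y :=
  chartDerivSymm 𝓘(ℝ, E) x y b

/-- The coefficients of the vector field `Z` in the preferred chart at `x`. -/
def fieldInChart (x : M) (Z : ∀ y : M, TangentSpace 𝓘(ℝ, E) y) : E → E :=
  (fun y ↦ chartDeriv 𝓘(ℝ, E) x y (Z y)) ∘ (extChartAt 𝓘(ℝ, E) x).symm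

variable {x y : M} {X Y Z : ∀ y : M, TangentSpace 𝓘(ℝ, E) y}

theorem coordField_add (x : M) (a b : E) :
    coordField x (a + b) = coordField x a + coordField x b := by
  ext y
  exact map_add _ _ _

theorem coordField_smul (x : M) (c : ℝ) (b : E) : coordField x (c • b) = c • coordField x b := by
  ext y
  exact map_smul _ _ _

theorem chartDeriv_coordField (b : E) (hy : y ∈ (chartAt E x).source) :
    chartDeriv 𝓘(ℝ, E) x y (coordField x b y) = b :=
  chartDeriv_chartDerivSymm hy b

theorem coordField_chartDeriv (hy : y ∈ (chartAt E x).source) (v : TangentSpace 𝓘(ℝ, E) y) :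
    coordField x (chartDeriv 𝓘(ℝ, E) x y v) y = v :=
  chartDerivSymm_chartDeriv hy v

theorem eventuallyEq_chartDeriv (hy : y ∈ (chartAt E x).source) :
    (fun z ↦ chartDeriv 𝓘(ℝ, E) x z (Z z)) =ᶠ[𝓝 y]
      fun z ↦ fieldInChart x Z (extChartAt 𝓘(ℝ, E) x z) :=
  eventuallyEq_comp_extChartAt hy _

theorem fieldInChart_extChartAt (hy : y ∈ (chartAt E x).source) :
    fieldInChart x Z (extChartAt 𝓘(ℝ, E) x y) = chartDeriv 𝓘(ℝ, E) x y (Z y) :=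
  (eventuallyEq_chartDeriv hy).self_of_nhds.symm

theorem contMDiffAt_section_iff_coord {n : WithTop ℕ∞} (hn : n ≤ ∞)
    (hy : y ∈ (chartAt E x).source) :
    CMDiffAt n (T% Z) y ↔ CMDiffAt n (fun z ↦ chartDeriv 𝓘(ℝ, E) x z (Z z)) y := by
  have : ContMDiffVectorBundle n E (TangentSpace 𝓘(ℝ, E) : M → Type _) 𝓘(ℝ, E) :=
    ContMDiffVectorBundle.of_le hn
  rw [Bundle.Trivialization.contMDiffAt_section_iff
    (trivializationAt E (TangentSpace 𝓘(ℝ, E)) x) (by simpa using hy)]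
  refine Filter.EventuallyEq.contMDiffAt_iff ?_
  filter_upwards [(chartAt E x).open_source.mem_nhds hy] with z hz
  rw [Trivialization.continuousLinearMapAt_apply, Trivialization.coe_linearMapAt_of_mem]
  simpa using hz

theorem mdifferentiableAt_section_iff_coord (hy : y ∈ (chartAt E x).source) :
    MDiffAt (T% Z) y ↔ MDiffAt (fun z ↦ chartDeriv 𝓘(ℝ, E) x z (Z z)) y := by
  rw [(trivializationAt E (TangentSpace 𝓘(ℝ, E)) x).mdifferentiableAt_section_iff 𝓘(ℝ, E) _
    (by simpa using hy)]
  refine Filter.EventuallyEq.mdifferentiableAt_iff ?_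
  filter_upwards [(chartAt E x).open_source.mem_nhds hy] with z hz
  rw [Trivialization.continuousLinearMapAt_apply, Trivialization.coe_linearMapAt_of_mem]
  simpa using hz

theorem contDiffAt_fieldInChart {n : WithTop ℕ∞} (hn : n ≤ ∞) (hy : y ∈ (chartAt E x).source)
    (hZ : CMDiffAt n (T% Z) y) :
    ContDiffAt ℝ n (fieldInChart x Z) (extChartAt 𝓘(ℝ, E) x y) :=
  contDiffAt_comp_extChartAt_symm hn hy ((contMDiffAt_section_iff_coord hn hy).1 hZ)

theorem differentiableAt_fieldInChart (hy : y ∈ (chartAt E x).source) (hZ : MDiffAt (T% Z) y) :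
    DifferentiableAt ℝ (fieldInChart x Z) (extChartAt 𝓘(ℝ, E) x y) :=
  differentiableAt_comp_extChartAt_symm hy ((mdifferentiableAt_section_iff_coord hy).1 hZ)

theorem contMDiffAt_coordField (b : E) (hy : y ∈ (chartAt E x).source) :
    CMDiffAt ∞ (T% (coordField x b)) y := by
  rw [contMDiffAt_section_iff_coord le_rfl hy]
  refine (contMDiffAt_const (c := b)).congr_of_eventuallyEq ?_
  filter_upwards [(chartAt E x).open_source.mem_nhds hy] with z hz
  exact chartDeriv_coordField b hz

theorem mdifferentiableAt_coordField (b : E) (hy : y ∈ (chartAt E x).source) :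
    MDiffAt (T% (coordField x b)) y :=
  (contMDiffAt_coordField b hy).mdifferentiableAt (by simp)

/-- The vector field on `E` with constant value `b`, typed as a section of the tangent bundle. -/
def constVectorField {E : Type*} [NormedAddCommGroup E] [NormedSpace ℝ E] (b z : E) :
    TangentSpace 𝓘(ℝ, E) z := b

theorem mpullback_constVectorField (b : E) (hy : y ∈ (chartAt E x).source) :
    VectorField.mpullback 𝓘(ℝ, E) 𝓘(ℝ, E) (extChartAt 𝓘(ℝ, E) x) (constVectorField b) y =
      coordField x b y := by
  have mfderiv_extChartAt :=
    TangentBundle.continuousLinearMapAt_trivializationAt (I := 𝓘(ℝ, E)) hy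
  have inverse_mfderiv : (mfderiv 𝓘(ℝ, E) 𝓘(ℝ, E) (extChartAt 𝓘(ℝ, E) x) y).inverse =
      chartDerivSymm 𝓘(ℝ, E) x y := by
    rw [← mfderiv_extChartAt]
    exact ContinuousLinearMap.inverse_eq
      (ContinuousLinearMap.ext (chartDeriv_chartDerivSymm (J := 𝓘(ℝ, E)) hy))
      (ContinuousLinearMap.ext (chartDerivSymm_chartDeriv (J := 𝓘(ℝ, E)) hy))
  rw [VectorField.mpullback_apply, inverse_mfderiv]
  rfl

theorem mlieBracket_coordField [CompleteSpace E] (a b : E) (hy : y ∈ (chartAt E x).source) :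
    VectorField.mlieBracket 𝓘(ℝ, E) (coordField x a) (coordField x b) y = 0 := by
  have coordField_eq (b : E) : coordField x b =ᶠ[𝓝 y] VectorField.mpullback 𝓘(ℝ, E) 𝓘(ℝ, E)
      (extChartAt 𝓘(ℝ, E) x) (constVectorField b) := by
    filter_upwards [(chartAt E x).open_source.mem_nhds hy] with z hz
    exact (mpullback_constVectorField b hz).symm
  have mdifferentiableAt_const (b : E) :
      MDiffAt (T% (constVectorField b)) (extChartAt 𝓘(ℝ, E) x y) := by
    refine ContMDiffAt.mdifferentiableAt (n := ∞) ?_ (by simp)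
    exact contMDiffAt_vectorSpace_iff_contDiffAt.2 contDiffAt_const
  have : IsManifold 𝓘(ℝ, E) (minSmoothness ℝ 2) M := by
    rw [minSmoothness_of_isRCLikeNormedField]; infer_instance
  have lieBracket_const : VectorField.mlieBracket 𝓘(ℝ, E) (constVectorField a)
      (constVectorField b) (extChartAt 𝓘(ℝ, E) x y) = 0 := by
    rw [← VectorField.mlieBracketWithin_univ, VectorField.mlieBracketWithin_eq_lieBracketWithin]
    change VectorField.lieBracketWithin ℝ (fun _ : E ↦ a) (fun _ ↦ b) Set.univ _ = (0 : E)
    simp [VectorField.lieBracketWithin]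
  rw [Filter.EventuallyEq.mlieBracket_vectorField_eq (coordField_eq a) (coordField_eq b),
    ← VectorField.mpullback_mlieBracket (n := ∞) (mdifferentiableAt_const a)
      (mdifferentiableAt_const b) (contMDiffAt_extChartAt' (I := 𝓘(ℝ, E)) hy)
      (by simp; norm_cast), VectorField.mpullback_apply]
  exact (congrArg _ lieBracket_const).trans (map_zero _)

theorem mvfderiv_chartForm_coordField (α : StrongDual ℝ E) (b : E)
    (hy : y ∈ (chartAt E x).source) :
    mvfderiv 𝓘(ℝ, E) (fun z ↦ chartForm 𝓘(ℝ, E) x α z (coordField x b z)) y = 0 := by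
  have eventually_const : (fun z ↦ chartForm 𝓘(ℝ, E) x α z (coordField x b z)) =ᶠ[𝓝 y]
      fun _ ↦ α b := by
    filter_upwards [(chartAt E x).open_source.mem_nhds hy] with z hz
    exact congrArg α (chartDeriv_coordField b hz)
  unfold mvfderiv
  rw [eventually_const.mfderiv_eq, mfderiv_const]
  ext; rfl

variable [FiniteDimensional ℝ E]

theorem exists_isSmoothVectorField_eventuallyEq [T2Space M] (b : E)
    (hy : y ∈ (chartAt E x).source) : ∃ X : ∀ y : M, TangentSpace 𝓘(ℝ, E) y,
      IsSmoothVectorField X ∧ ∀ᶠ z in 𝓝 y, X z = coordField x b z := by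
  obtain ⟨ρ, -, hρ⟩ := (SmoothBumpFunction.nhds_basis_tsupport (I := 𝓘(ℝ, E)) y).mem_iff.1
    ((chartAt E x).open_source.mem_nhds hy)
  refine ⟨(ρ : M → ℝ) • coordField x b, ?_, ?_⟩
  · exact ContMDiffOn.smul_section_of_tsupport ρ.contMDiff.contMDiffOn (chartAt E x).open_source hρ
      fun z hz ↦ (contMDiffAt_coordField b hz).contMDiffWithinAt
  · filter_upwards [ρ.eventuallyEq_one] with z hz
    simp [hz]

theorem exists_smoothOneForm_eventuallyEq [T2Space M] (α : StrongDual ℝ E)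
    (hy : y ∈ (chartAt E x).source) : ∃ β : ∀ y : M, TangentSpace 𝓘(ℝ, E) y →L[ℝ] ℝ,
      (∀ y, SmoothOneFormAt β y) ∧ ∀ᶠ z in 𝓝 y, β z = chartForm 𝓘(ℝ, E) x α z := by
  obtain ⟨ρ, -, hρ⟩ := (SmoothBumpFunction.nhds_basis_tsupport (I := 𝓘(ℝ, E)) y).mem_iff.1
    ((chartAt E x).open_source.mem_nhds hy)
  refine ⟨(ρ : M → ℝ) • chartForm 𝓘(ℝ, E) x α, ?_, ?_⟩
  · exact ContMDiffOn.smul_section_of_tsupport ρ.contMDiff.contMDiffOn (chartAt E x).open_source hρ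
      fun z hz ↦ (smoothOneFormAt_chartForm α hz).contMDiffWithinAt
  · filter_upwards [ρ.eventuallyEq_one] with z hz
    simp [hz]

variable (cov : CovariantDerivative 𝓘(ℝ, E) E (TangentSpace 𝓘(ℝ, E) : M → Type _))

open Classical in
/-- The Christoffel symbol of `cov` in the preferred chart at `x`: `christoffel cov x z b v` is the
derivative of the field with constant coefficients `b` in the direction `v`. It is `0` off the
target of the chart. -/
def christoffel (x : M) (z : E) : E →L[ℝ] E →L[ℝ] E :=
  if hy : (extChartAt 𝓘(ℝ, E) x).symm z ∈ (chartAt E x).source then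
    LinearMap.toContinuousLinearMap
      { toFun b := (chartDeriv 𝓘(ℝ, E) x _).comp ((cov (coordField x b) _).comp
          (chartDerivSymm 𝓘(ℝ, E) x ((extChartAt 𝓘(ℝ, E) x).symm z)))
        map_add' a b := by
          rw [coordField_add, cov.isCovariantDerivativeOn.add (mdifferentiableAt_coordField a hy)
            (mdifferentiableAt_coordField b hy)]
          ext v
          exact map_add (chartDeriv 𝓘(ℝ, E) x _) _ _
        map_smul' c a := by
          rw [coordField_smul, cov.isCovariantDerivativeOn.smul_const c
            (mdifferentiableAt_coordField a hy)]
          ext v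
          exact map_smul (chartDeriv 𝓘(ℝ, E) x _) c _ }
  else 0

theorem christoffel_apply (hy : y ∈ (chartAt E x).source) (b : E) (v : TangentSpace 𝓘(ℝ, E) y) :
    christoffel cov x (extChartAt 𝓘(ℝ, E) x y) b (chartDeriv 𝓘(ℝ, E) x y v) =
      chartDeriv 𝓘(ℝ, E) x y (cov (coordField x b) y v) := by
  have apply_at (y' : M) (h : y' = y) : chartDeriv 𝓘(ℝ, E) x y' (cov (coordField x b) y'
      (chartDerivSymm 𝓘(ℝ, E) x y' (chartDeriv 𝓘(ℝ, E) x y v))) =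
        chartDeriv 𝓘(ℝ, E) x y (cov (coordField x b) y v) := by
    subst h
    rw [chartDerivSymm_chartDeriv hy]
  have symm_extChartAt : (extChartAt 𝓘(ℝ, E) x).symm (extChartAt 𝓘(ℝ, E) x y) = y :=
    (extChartAt 𝓘(ℝ, E) x).left_inv (by simpa using hy)
  unfold christoffel
  rw [dif_pos (by rwa [symm_extChartAt])]
  exact apply_at _ symm_extChartAt

variable {cov}

theorem cov_coordField_comm (htor : cov.torsion = 0) (hy : y ∈ (chartAt E x).source) (a b : E) :
    cov (coordField x a) y (coordField x b y) = cov (coordField x b) y (coordField x a y) := by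
  have torsion_apply := cov.torsion_eq_zero_iff.1 htor (mdifferentiableAt_coordField (x := x) b hy)
    (mdifferentiableAt_coordField (x := x) a hy)
  rwa [mlieBracket_coordField _ _ hy, sub_eq_zero] at torsion_apply

theorem christoffel_symm (htor : cov.torsion = 0) (hy : y ∈ (chartAt E x).source) (a b : E) :
    christoffel cov x (extChartAt 𝓘(ℝ, E) x y) a b =
      christoffel cov x (extChartAt 𝓘(ℝ, E) x y) b a := by
  calc christoffel cov x (extChartAt 𝓘(ℝ, E) x y) a b
    _ = chartDeriv 𝓘(ℝ, E) x y (cov (coordField x a) y (coordField x b y)) := by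
      rw [← christoffel_apply cov hy, chartDeriv_coordField b hy]
    _ = chartDeriv 𝓘(ℝ, E) x y (cov (coordField x b) y (coordField x a y)) := by
      rw [cov_coordField_comm htor hy]
    _ = christoffel cov x (extChartAt 𝓘(ℝ, E) x y) b a := by
      rw [← christoffel_apply cov hy, chartDeriv_coordField a hy]

theorem contMDiffAt_cov_coordField [T2Space M]
    (hcov : CovariantDerivative.ContMDiffCovariantDerivative cov ∞) (b : E) (x : M) :
    ContMDiffAt 𝓘(ℝ, E) (𝓘(ℝ, E).prod 𝓘(ℝ, E →L[ℝ] E)) ∞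
      (fun z ↦ TotalSpace.mk' (E →L[ℝ] E)
        (E := fun y : M ↦ TangentSpace 𝓘(ℝ, E) y →L[ℝ] TangentSpace 𝓘(ℝ, E) y) z
        (cov (coordField x b) z)) x := by
  obtain ⟨X, hX, hXe⟩ := exists_isSmoothVectorField_eventuallyEq b (mem_chart_source E x)
  have contMDiffOn_cov := hcov.contMDiff.contMDiff (σ := X) (by simpa using! hX.contMDiffOn)
  refine (contMDiffOn_cov.contMDiffAt Filter.univ_mem).congr_of_eventuallyEq ?_
  filter_upwards [hXe.eventually_nhds, (chartAt E x).open_source.mem_nhds (mem_chart_source E x)]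
    with z hz hzx
  have : cov (coordField x b) z = cov X z :=
    cov.isCovariantDerivativeOn.congr_of_eventuallyEq (mdifferentiableAt_coordField b hzx)
      ((hX z).mdifferentiableAt (by simp)) Filter.univ_mem (hz.mono fun _ h ↦ h.symm)
  rw [this]

theorem contDiffAt_christoffel [T2Space M]
    (hcov : CovariantDerivative.ContMDiffCovariantDerivative cov ∞) (x : M) :
    ContDiffAt ℝ ∞ (christoffel cov x) (extChartAt 𝓘(ℝ, E) x x) := by
  refine contDiffAt_of_clm_apply fun b ↦ ?_
  have contMDiffAt_inCoordinates :=
    ((contMDiffAt_hom_bundle _).1 (contMDiffAt_cov_coordField hcov b x)).2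
  refine (contDiffAt_comp_extChartAt_symm le_rfl (mem_chart_source E x)
    contMDiffAt_inCoordinates).congr_of_eventuallyEq ?_
  filter_upwards [extChartAt_target_mem_nhds (I := 𝓘(ℝ, E)) x] with z hz
  have mem_source : (extChartAt 𝓘(ℝ, E) x).symm z ∈ (chartAt E x).source := by
    simpa using (extChartAt 𝓘(ℝ, E) x).map_target hz
  unfold christoffel
  rw [dif_pos mem_source]
  rfl

theorem covDerivOneForm_chartForm (hy : y ∈ (chartAt E x).source) (α : StrongDual ℝ E)
    (v : TangentSpace 𝓘(ℝ, E) y) :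
    covDerivOneForm cov ((smoothOneFormAt_chartForm (J := 𝓘(ℝ, E)) α hy).mdifferentiableAt
      (by simp)) v =
    chartForm 𝓘(ℝ, E) x (-α.comp ((christoffel cov x (extChartAt 𝓘(ℝ, E) x y)).flip
      (chartDeriv 𝓘(ℝ, E) x y v))) y := by
  ext u
  obtain ⟨b, rfl⟩ : ∃ b, u = coordField x b y := ⟨_, (coordField_chartDeriv hy u).symm⟩
  rw [covDerivOneForm_apply cov _ v (mdifferentiableAt_coordField b hy),
    mvfderiv_chartForm_coordField α b hy]
  simp only [chartForm, ContinuousLinearMap.comp_apply, neg_apply, ContinuousLinearMap.flip_apply,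
    chartDeriv_coordField b hy, christoffel_apply cov hy, zero_apply, zero_sub]

theorem apply_chartDeriv_cov (hy : y ∈ (chartAt E x).source) (hZ : MDiffAt (T% Z) y)
    (α : StrongDual ℝ E) (v : TangentSpace 𝓘(ℝ, E) y) :
    α (chartDeriv 𝓘(ℝ, E) x y (cov Z y v)) =
      mvfderiv 𝓘(ℝ, E) (fun z ↦ α (chartDeriv 𝓘(ℝ, E) x z (Z z))) y v
        + α (christoffel cov x (extChartAt 𝓘(ℝ, E) x y) (chartDeriv 𝓘(ℝ, E) x y (Z y))
            (chartDeriv 𝓘(ℝ, E) x y v)) := by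
  have hα := (smoothOneFormAt_chartForm (J := 𝓘(ℝ, E)) α hy).mdifferentiableAt (by simp)
  have leibniz := covDerivOneForm_apply cov hα v hZ
  rw [covDerivOneForm_chartForm hy, eq_sub_iff_add_eq'] at leibniz
  exact eq_add_of_add_neg_eq leibniz

theorem chartDeriv_cov (hy : y ∈ (chartAt E x).source) (hZ : MDiffAt (T% Z) y)
    (V : ∀ y : M, TangentSpace 𝓘(ℝ, E) y) :
    chartDeriv 𝓘(ℝ, E) x y (cov Z y (V y)) =
      coordCovDeriv (christoffel cov x) (fieldInChart x Z) (fieldInChart x V)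
        (extChartAt 𝓘(ℝ, E) x y) := by
  refine (SeparatingDual.eq_iff_forall_dual_eq (R := ℝ)).2 fun α ↦ ?_
  rw [apply_chartDeriv_cov hy hZ α (V y), coordCovDeriv, fieldInChart_extChartAt hy,
    fieldInChart_extChartAt hy, map_add]
  congr 1
  exact mvfderiv_apply_of_eventuallyEq_comp_extChartAt hy
    (α.hasFDerivAt.comp _ (differentiableAt_fieldInChart hy hZ).hasFDerivAt)
    ((eventuallyEq_chartDeriv hy).fun_comp α) (V y)

theorem fieldInChart_cov (hZ : CMDiffAt 1 (T% Z) x) (V : ∀ y : M, TangentSpace 𝓘(ℝ, E) y) :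
    fieldInChart x (fun y ↦ cov Z y (V y)) =ᶠ[𝓝 (extChartAt 𝓘(ℝ, E) x x)]
      coordCovDeriv (christoffel cov x) (fieldInChart x Z) (fieldInChart x V) := by
  have tendsto_symm : Filter.Tendsto (extChartAt 𝓘(ℝ, E) x).symm
      (𝓝 (extChartAt 𝓘(ℝ, E) x x)) (𝓝 x) := by
    simpa [ContinuousAt] using continuousAt_extChartAt_symm (I := 𝓘(ℝ, E)) x
  filter_upwards [extChartAt_target_mem_nhds (I := 𝓘(ℝ, E)) x,
    tendsto_symm.eventually ((chartAt E x).open_source.mem_nhds (mem_chart_source E x)),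
    tendsto_symm.eventually ((contMDiffAt_iff_contMDiffAt_nhds (by simp)).1 hZ)] with z hz hzx hzZ
  have cov_in_chart := chartDeriv_cov (cov := cov) hzx (hzZ.mdifferentiableAt (by simp)) V
  rwa [(extChartAt 𝓘(ℝ, E) x).right_inv hz] at cov_in_chart

variable [T2Space M]

theorem chartDeriv_cov_cov (hcov : CovariantDerivative.ContMDiffCovariantDerivative cov ∞)
    (hY : MDiffAt (T% Y) x) (hZ : CMDiffAt 2 (T% Z) x) (X : ∀ y : M, TangentSpace 𝓘(ℝ, E) y) :
    chartDeriv 𝓘(ℝ, E) x x (cov (fun y ↦ cov Z y (Y y)) x (X x)) =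
      coordCovDeriv (christoffel cov x) (coordCovDeriv (christoffel cov x) (fieldInChart x Z)
        (fieldInChart x Y)) (fieldInChart x X) (extChartAt 𝓘(ℝ, E) x x) := by
  have hx := mem_chart_source E x
  have differentiableAt_coord := (hasFDerivAt_coordCovDeriv
    ((contDiffAt_christoffel hcov x).differentiableAt (by simp))
    (differentiableAt_fieldInChart hx hY)
    (contDiffAt_fieldInChart (by norm_cast) hx hZ)).differentiableAt
  have cov_in_chart := fieldInChart_cov (cov := cov) (hZ.of_le (by norm_num)) Y
  have mdifferentiableAt_cov : MDiffAt (T% (fun y ↦ cov Z y (Y y))) x := by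
    rw [mdifferentiableAt_section_iff_coord hx]
    exact (hasMFDerivAt_comp_extChartAt hx (differentiableAt_coord.congr_of_eventuallyEq
      cov_in_chart).hasFDerivAt).mdifferentiableAt.congr_of_eventuallyEq
      (eventuallyEq_chartDeriv hx)
  rw [chartDeriv_cov hx mdifferentiableAt_cov, coordCovDeriv, cov_in_chart.fderiv_eq,
    cov_in_chart.self_of_nhds]
  rfl

theorem chartDeriv_connectionCurvature
    (hcov : CovariantDerivative.ContMDiffCovariantDerivative cov ∞) (htor : cov.torsion = 0)
    (hX : MDiffAt (T% X) x) (hY : MDiffAt (T% Y) x) (hZ : CMDiffAt 2 (T% Z) x) :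
    chartDeriv 𝓘(ℝ, E) x x (connectionCurvature cov X Y Z x) =
      christoffelCurvature (christoffel cov x) (extChartAt 𝓘(ℝ, E) x x)
        (chartDeriv 𝓘(ℝ, E) x x (X x)) (chartDeriv 𝓘(ℝ, E) x x (Y x))
        (chartDeriv 𝓘(ℝ, E) x x (Z x)) := by
  have hx := mem_chart_source E x
  have lieBracket_eq : VectorField.mlieBracket 𝓘(ℝ, E) X Y x = cov Y x (X x) - cov X x (Y x) :=
    (cov.torsion_eq_zero_iff.1 htor hX hY).symm
  have lieBracket_in_chart : fieldInChart x (VectorField.mlieBracket 𝓘(ℝ, E) X Y)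
      (extChartAt 𝓘(ℝ, E) x x) =
        (coordCovDeriv (christoffel cov x) (fieldInChart x Y) (fieldInChart x X)
          - coordCovDeriv (christoffel cov x) (fieldInChart x X) (fieldInChart x Y))
          (extChartAt 𝓘(ℝ, E) x x) := by
    rw [fieldInChart_extChartAt hx, lieBracket_eq, map_sub, chartDeriv_cov hx hX,
      chartDeriv_cov hx hY, Pi.sub_apply]
  rw [connectionCurvature, map_sub, map_sub, chartDeriv_cov_cov hcov hY hZ,
    chartDeriv_cov_cov hcov hX hZ, chartDeriv_cov hx (hZ.mdifferentiableAt (by simp)),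
    ← fieldInChart_extChartAt hx, ← fieldInChart_extChartAt hx, ← fieldInChart_extChartAt hx,
    ← coordCovDeriv_comm_sub_eq_christoffelCurvature
      ((contDiffAt_christoffel hcov x).differentiableAt (by simp)) (christoffel_symm htor hx)
      (differentiableAt_fieldInChart hx hX) (differentiableAt_fieldInChart hx hY)
      (contDiffAt_fieldInChart (by norm_cast) hx hZ)]
  congr 1
  exact congrArg (fun v ↦ fderiv ℝ (fieldInChart x Z) _ v + christoffel cov x _ _ v)
    lieBracket_in_chart

end ConnectionInChart

section BivectorInChart

variable {E : Type*} [NormedAddCommGroup E] [NormedSpace ℝ E]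
  {M : Type*} [TopologicalSpace M] [ChartedSpace E M] [IsManifold 𝓘(ℝ, E) ∞ M]

/-- The contravariant tensor `w` in the preferred chart at `x`. -/
def bivectorInChart (w : ContravariantTwoTensor 𝓘(ℝ, E) M) (x : M) (z : E) : DualBilinForm E :=
  (ContinuousLinearMap.precomp ℝ (ContinuousLinearMap.precomp ℝ
    (chartDeriv 𝓘(ℝ, E) x ((extChartAt 𝓘(ℝ, E) x).symm z)))).comp
    ((w ((extChartAt 𝓘(ℝ, E) x).symm z)).comp (ContinuousLinearMap.precomp ℝ
      (chartDeriv 𝓘(ℝ, E) x ((extChartAt 𝓘(ℝ, E) x).symm z))))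

theorem bivectorInChart_apply (w : ContravariantTwoTensor 𝓘(ℝ, E) M) (x : M) (z : E)
    (α β : StrongDual ℝ E) : bivectorInChart w x z α β =
      w ((extChartAt 𝓘(ℝ, E) x).symm z)
        (chartForm 𝓘(ℝ, E) x α ((extChartAt 𝓘(ℝ, E) x).symm z))
        (chartForm 𝓘(ℝ, E) x β ((extChartAt 𝓘(ℝ, E) x).symm z)) := rfl

variable {w : ContravariantTwoTensor 𝓘(ℝ, E) M} {x y : M}

theorem hasChartExpression_bivectorInChart (w : ContravariantTwoTensor 𝓘(ℝ, E) M) (x : M) :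
    HasChartExpression w x (bivectorInChart w x) := by
  intro y hy α β
  rw [bivectorInChart_apply, (extChartAt 𝓘(ℝ, E) x).left_inv (by simpa using hy)]

variable [FiniteDimensional ℝ E]

theorem contDiffAt_bivectorInChart (hw : IsBivectorField w) (x : M) :
    ContDiffAt ℝ ∞ (bivectorInChart w x) (extChartAt 𝓘(ℝ, E) x x) := by
  have hx := mem_chart_source E x
  refine contDiffAt_of_clm_apply fun α ↦ contDiffAt_of_clm_apply fun β ↦ ?_
  exact contDiffAt_comp_extChartAt_symm le_rfl hx
    (hw.smooth _ _ x (smoothOneFormAt_chartForm α hx) (smoothOneFormAt_chartForm β hx))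

theorem chartDeriv_bivectorSharp (hy : y ∈ (chartAt E x).source)
    (β : TangentSpace 𝓘(ℝ, E) y →L[ℝ] ℝ) :
    chartDeriv 𝓘(ℝ, E) x y (bivectorSharp w y β) =
      sharp (bivectorInChart w x (extChartAt 𝓘(ℝ, E) x y))
        (β.comp (chartDerivSymm 𝓘(ℝ, E) x y)) := by
  refine (SeparatingDual.eq_iff_forall_dual_eq (R := ℝ)).2 fun α ↦ ?_
  rw [apply_sharp_eq, ← hasChartExpression_bivectorInChart w x y hy, chartForm_coord hy]
  exact apply_sharp w y β (chartForm 𝓘(ℝ, E) x α y)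

theorem contMDiffAt_bivectorSharp (hw : IsBivectorField w)
    {β : ∀ y : M, TangentSpace 𝓘(ℝ, E) y →L[ℝ] ℝ} (hβ : SmoothOneFormAt β x) :
    CMDiffAt ∞ (T% (fun y ↦ bivectorSharp w y (β y))) x := by
  have hx := mem_chart_source E x
  rw [contMDiffAt_section_iff_coord le_rfl hx]
  have contMDiffAt_form := (contMDiffAt_comp_extChartAt le_rfl hx
    (contDiffAt_bivectorInChart hw x)).clm_apply hβ.contMDiffAt_coord
  refine ((bidualInv E).contMDiff.contMDiffAt.comp x contMDiffAt_form).congr_of_eventuallyEq ?_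
  filter_upwards [(chartAt E x).open_source.mem_nhds hx] with z hz
  exact chartDeriv_bivectorSharp hz _

variable {cov : CovariantDerivative 𝓘(ℝ, E) E (TangentSpace 𝓘(ℝ, E) : M → Type _)}

theorem fderiv_bivectorInChart (hcov : IsPoissonConnection cov w)
    (hw : IsBivectorField w) (x : M) (t : E) (α β : StrongDual ℝ E) :
    fderiv ℝ (bivectorInChart w x) (extChartAt 𝓘(ℝ, E) x x) t α β =
      -bivectorInChart w x (extChartAt 𝓘(ℝ, E) x x)
          (α.comp ((christoffel cov x (extChartAt 𝓘(ℝ, E) x x)).flip t)) β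
        - bivectorInChart w x (extChartAt 𝓘(ℝ, E) x x) α
          (β.comp ((christoffel cov x (extChartAt 𝓘(ℝ, E) x x)).flip t)) := by
  have hx := mem_chart_source E x
  have hd : DifferentiableAt ℝ (bivectorInChart w x) (extChartAt 𝓘(ℝ, E) x x) :=
    (contDiffAt_bivectorInChart hw x).differentiableAt (by simp)
  have hdαβ : DifferentiableAt ℝ (fun z ↦ bivectorInChart w x z α β) (extChartAt 𝓘(ℝ, E) x x) :=
    (hd.clm_apply (differentiableAt_const α)).clm_apply (differentiableAt_const β)
  have mvfderiv_eq :
      mvfderiv 𝓘(ℝ, E) (fun y ↦ w y (chartForm 𝓘(ℝ, E) x α y) (chartForm 𝓘(ℝ, E) x β y)) x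
        (coordField x t x) = fderiv ℝ (bivectorInChart w x) (extChartAt 𝓘(ℝ, E) x x) t α β := by
    rw [fderiv_apply_apply hd, mvfderiv_apply_of_eventuallyEq_comp_extChartAt hx hdαβ.hasFDerivAt,
      chartDeriv_coordField _ hx]
    filter_upwards [(chartAt E x).open_source.mem_nhds hx] with z hz
    exact hasChartExpression_bivectorInChart w x z hz α β
  have parallel := hcov.parallel _ _ x (smoothOneFormAt_chartForm α hx)
    (smoothOneFormAt_chartForm β hx) (coordField x t x)
  rw [mvfderiv_eq, covDerivOneForm_chartForm hx, covDerivOneForm_chartForm hx,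
    hasChartExpression_bivectorInChart w x x hx, hasChartExpression_bivectorInChart w x x hx,
    chartDeriv_coordField _ hx] at parallel
  simp only [map_neg, neg_apply] at parallel
  linarith

theorem eventually_christoffel_symm (htor : cov.torsion = 0) (x : M) :
    ∀ᶠ z in 𝓝 (extChartAt 𝓘(ℝ, E) x x), ∀ u v,
      christoffel cov x z u v = christoffel cov x z v u := by
  filter_upwards [extChartAt_target_mem_nhds (I := 𝓘(ℝ, E)) x] with z hz u v
  have symm_at := christoffel_symm htor (x := x)
    (y := (extChartAt 𝓘(ℝ, E) x).symm z) (by simpa using (extChartAt 𝓘(ℝ, E) x).map_target hz) u v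
  rwa [(extChartAt 𝓘(ℝ, E) x).right_inv hz] at symm_at

variable [T2Space M]

theorem isPoissonChristoffel_christoffel (hcov : IsPoissonConnection cov w)
    (hw : IsBivectorField w) (x : M) :
    IsPoissonChristoffel (bivectorInChart w x) (christoffel cov x) (extChartAt 𝓘(ℝ, E) x x) := by
  have skew : ∀ α β, bivectorInChart w x (extChartAt 𝓘(ℝ, E) x x) α β =
      -bivectorInChart w x (extChartAt 𝓘(ℝ, E) x x) β α := fun α β ↦ by
    rw [bivectorInChart_apply, bivectorInChart_apply]
    exact hw.skew _ _ _
  exact ⟨contDiffAt_bivectorInChart hw x, contDiffAt_christoffel hcov.smooth x, skew,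
    eventually_christoffel_symm hcov.torsion_free x, fderiv_bivectorInChart hcov hw x⟩

theorem chartDeriv_connectionCurvature_bivectorSharp (hw : IsBivectorField w)
    (hcov : IsPoissonConnection cov w) {α : ∀ y : M, TangentSpace 𝓘(ℝ, E) y →L[ℝ] ℝ}
    (hα : SmoothOneFormAt α x) {X Y : ∀ y : M, TangentSpace 𝓘(ℝ, E) y} (hX : MDiffAt (T% X) x)
    (hY : MDiffAt (T% Y) x) :
    chartDeriv 𝓘(ℝ, E) x x (connectionCurvature cov X Y (fun y ↦ bivectorSharp w y (α y)) x) =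
      christoffelCurvature (christoffel cov x) (extChartAt 𝓘(ℝ, E) x x)
        (chartDeriv 𝓘(ℝ, E) x x (X x)) (chartDeriv 𝓘(ℝ, E) x x (Y x))
        (sharp (bivectorInChart w x (extChartAt 𝓘(ℝ, E) x x))
          ((α x).comp (chartDerivSymm 𝓘(ℝ, E) x x))) := by
  rw [chartDeriv_connectionCurvature hcov.smooth hcov.torsion_free hX hY
    ((contMDiffAt_bivectorSharp hw hα).of_le (by norm_cast)),
    chartDeriv_bivectorSharp (mem_chart_source E x)]

theorem forall_connectionCurvature_bivectorSharp_eq_zero_iff (hw : IsBivectorField w)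
    (hcov : IsPoissonConnection cov w) :
    (∀ α : ∀ y : M, TangentSpace 𝓘(ℝ, E) y →L[ℝ] ℝ, (∀ x, SmoothOneFormAt α x) →
      ∀ X Y : ∀ y : M, TangentSpace 𝓘(ℝ, E) y, IsSmoothVectorField X → IsSmoothVectorField Y →
        ∀ x : M, connectionCurvature cov X Y (fun y ↦ bivectorSharp w y (α y)) x = 0) ↔
    ∀ (x : M) (u v : E) (α : StrongDual ℝ E),
      christoffelCurvature (christoffel cov x) (extChartAt 𝓘(ℝ, E) x x) u v
        (sharp (bivectorInChart w x (extChartAt 𝓘(ℝ, E) x x)) α) = 0 := by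
  constructor
  · intro h x u v α
    have hx := mem_chart_source E x
    obtain ⟨β, hβ, hβα⟩ := exists_smoothOneForm_eventuallyEq α hx
    obtain ⟨X, hX, hXu⟩ := exists_isSmoothVectorField_eventuallyEq u hx
    obtain ⟨Y, hY, hYv⟩ := exists_isSmoothVectorField_eventuallyEq v hx
    have curvature_eq := chartDeriv_connectionCurvature_bivectorSharp hw hcov (hβ x)
      ((hX x).mdifferentiableAt (by simp)) ((hY x).mdifferentiableAt (by simp))
    have comp_symm : (chartForm 𝓘(ℝ, E) x α x).comp (chartDerivSymm 𝓘(ℝ, E) x x) = α := by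
      ext b
      exact congrArg α (chartDeriv_chartDerivSymm hx b)
    rw [h β hβ X Y hX hY x, hXu.self_of_nhds, hYv.self_of_nhds, hβα.self_of_nhds,
      chartDeriv_coordField _ hx, chartDeriv_coordField _ hx, map_zero, comp_symm] at curvature_eq
    exact curvature_eq.symm
  · intro h α hα X Y hX hY x
    rw [← chartDerivSymm_chartDeriv (mem_chart_source E x) (connectionCurvature cov X Y _ x),
      chartDeriv_connectionCurvature_bivectorSharp hw hcov (hα x)
        ((hX x).mdifferentiableAt (by simp)) ((hY x).mdifferentiableAt (by simp)), h]
    exact map_zero _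

end BivectorInChart

section CotangentChart

variable {E : Type*} [NormedAddCommGroup E] [NormedSpace ℝ E]
  {M : Type*} [TopologicalSpace M] [ChartedSpace E M] [IsManifold 𝓘(ℝ, E) ∞ M]

theorem mem_chartAt_cotangent_source (ξ η : CotangentBundle E M) :
    η ∈ (chartAt (ModelProd E (E →L[ℝ] ℝ)) ξ).source ↔ η.1 ∈ (chartAt E ξ.1).source := by
  rw [← extChartAt_source (cotangentModel E), FiberBundle.extChartAt]
  simp only [mfld_simps]
  exact ⟨fun h ↦ by simpa using h.1, fun h ↦ by simp [h]⟩

/-- The local extension of the covector `p` at `x` which is constant in the preferred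
trivialization at `x`; the horizontal lift is defined through it. -/
abbrev extendCovector {x : M} (p : TangentSpace 𝓘(ℝ, E) x →L[ℝ] ℝ) (y : M) :
    TangentSpace 𝓘(ℝ, E) y →L[ℝ] ℝ :=
  FiberBundle.extend (E →L[ℝ] ℝ) (E := fun y : M ↦ TangentSpace 𝓘(ℝ, E) y →L[ℝ] ℝ) p y

theorem trivializationAt_cotangent_chartForm {x y : M} (hy : y ∈ (chartAt E x).source)
    (α : StrongDual ℝ E) :
    (trivializationAt (E →L[ℝ] ℝ) (fun y : M ↦ TangentSpace 𝓘(ℝ, E) y →L[ℝ] ℝ) x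
      ⟨y, chartForm 𝓘(ℝ, E) x α y⟩).2 = α := by
  ext v
  have chartDeriv_symm := chartDeriv_chartDerivSymm (J := 𝓘(ℝ, E)) hy v
  simp only [hom_trivializationAt_apply, ContinuousLinearMap.inCoordinates, chartForm,
    ContinuousLinearMap.comp_apply, chartDeriv_symm]
  simp

theorem extendCovector_eventuallyEq_chartForm (x : M) (p : TangentSpace 𝓘(ℝ, E) x →L[ℝ] ℝ) :
    ∀ᶠ z in 𝓝 x, extendCovector p z =
      chartForm 𝓘(ℝ, E) x (p.comp (chartDerivSymm 𝓘(ℝ, E) x x)) z := by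
  have hx := mem_chart_source E x
  filter_upwards [(chartAt E x).open_source.mem_nhds hx] with z hz
  have coord_self := trivializationAt_cotangent_chartForm hx (p.comp (chartDerivSymm 𝓘(ℝ, E) x x))
  rw [chartForm_coord hx] at coord_self
  have symm_coord := (trivializationAt (E →L[ℝ] ℝ)
    (fun y : M ↦ TangentSpace 𝓘(ℝ, E) y →L[ℝ] ℝ) x).symm_proj_apply
      ⟨z, chartForm 𝓘(ℝ, E) x (p.comp (chartDerivSymm 𝓘(ℝ, E) x x)) z⟩ (by simpa using hz)
  rw [trivializationAt_cotangent_chartForm hz] at symm_coord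
  rw [extendCovector, FiberBundle.extend, coord_self]
  exact symm_coord

theorem hasMFDerivAt_apply_extChartAt_cotangent [FiniteDimensional ℝ E] {ξ η : CotangentBundle E M}
    (hη : η.1 ∈ (chartAt E ξ.1).source) (Φ : StrongDual ℝ (PhaseSpace E)) :
    HasMFDerivAt (cotangentModel E) 𝓘(ℝ, ℝ) (fun ζ : CotangentBundle E M ↦
        Φ (extChartAt 𝓘(ℝ, E) ξ.1 ζ.1, 0) + ζ.2 (coordField ξ.1 (verticalPart Φ) ζ.1)) η
      (chartForm (cotangentModel E) ξ Φ η) := by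
  refine (hasMFDerivAt_comp_extChartAt ((mem_chartAt_cotangent_source ξ η).2 hη)
    Φ.hasFDerivAt).congr_of_eventuallyEq (Filter.Eventually.of_forall fun ζ ↦ ?_)
  have momentum_eq : ζ.2 (coordField ξ.1 (verticalPart Φ) ζ.1) =
      (ζ.2.comp (chartDerivSymm 𝓘(ℝ, E) ξ.1 ζ.1)) (verticalPart Φ) := rfl
  dsimp only
  rw [momentum_eq, apply_verticalPart, ← map_add, extChartAt_cotangent_apply, Prod.mk_add_mk,
    add_zero, zero_add]
  rfl

theorem chartForm_cotangent_inr [FiniteDimensional ℝ E] {ξ η : CotangentBundle E M}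
    (hη : η.1 ∈ (chartAt E ξ.1).source) (Φ : StrongDual ℝ (PhaseSpace E)) (q : StrongDual ℝ E) :
    chartForm (cotangentModel E) ξ Φ η (show E × (E →L[ℝ] ℝ) from (0, q)) =
      q (coordField ξ.1 (verticalPart Φ) η.1) := by
  have deriv_fibre := (hasMFDerivAt_comp_cotangent (E := E) (G := ℝ) η.1 η.2 _
    (hasMFDerivAt_apply_extChartAt_cotangent hη Φ)).2
  have deriv_eval := ((ContinuousLinearMap.apply ℝ ℝ
    (show E from coordField ξ.1 (verticalPart Φ) η.1)).hasFDerivAt (x := η.2)).const_add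
      (Φ (extChartAt 𝓘(ℝ, E) ξ.1 η.1, 0))
  exact DFunLike.congr_fun (hasMFDerivAt_unique deriv_fibre deriv_eval.hasMFDerivAt) q

variable [FiniteDimensional ℝ E]
  (cov : CovariantDerivative 𝓘(ℝ, E) E (TangentSpace 𝓘(ℝ, E) : M → Type _))

/-- The covariant derivative at `x` of the local extension `extendCovector p`; its negative is the
fibre component of the horizontal lift at `p`. -/
abbrev covDerivExtend {x : M} (p : TangentSpace 𝓘(ℝ, E) x →L[ℝ] ℝ) (v : TangentSpace 𝓘(ℝ, E) x) :
    TangentSpace 𝓘(ℝ, E) x →L[ℝ] ℝ :=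
  covDerivOneForm cov (FiberBundle.mdifferentiableAt_extend 𝓘(ℝ, E) (E →L[ℝ] ℝ)
    (V := fun y : M ↦ TangentSpace 𝓘(ℝ, E) y →L[ℝ] ℝ) p) v

theorem covDerivExtend_apply {x : M} (p : TangentSpace 𝓘(ℝ, E) x →L[ℝ] ℝ)
    (v : TangentSpace 𝓘(ℝ, E) x) {Y : ∀ y : M, TangentSpace 𝓘(ℝ, E) y} (hY : MDiffAt (T% Y) x) :
    covDerivExtend cov p v (Y x) =
      mvfderiv 𝓘(ℝ, E) (fun z ↦ extendCovector p z (Y z)) x v - p (cov Y x v) := by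
  rw [covDerivExtend, covDerivOneForm_apply cov _ v hY, FiberBundle.extend_apply_self]

theorem covDerivExtend_coordField (x : M) (p : TangentSpace 𝓘(ℝ, E) x →L[ℝ] ℝ)
    (v : TangentSpace 𝓘(ℝ, E) x) (b : E) :
    covDerivExtend cov p v (coordField x b x) = -p (cov (coordField x b) x v) := by
  have hx := mem_chart_source E x
  have mvfderiv_eq_zero :
      mvfderiv 𝓘(ℝ, E) (fun z ↦ extendCovector p z (coordField x b z)) x = 0 := by
    have eventually_eq : (fun z ↦ extendCovector p z (coordField x b z)) =ᶠ[𝓝 x] fun z ↦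
        chartForm 𝓘(ℝ, E) x (p.comp (chartDerivSymm 𝓘(ℝ, E) x x)) z (coordField x b z) :=
      (extendCovector_eventuallyEq_chartForm x p).mono fun z hz ↦
        DFunLike.congr_fun hz (coordField x b z)
    rw [← mvfderiv_chartForm_coordField (p.comp (chartDerivSymm 𝓘(ℝ, E) x x)) b hx, mvfderiv,
      eventually_eq.mfderiv_eq]
    rfl
  rw [covDerivExtend_apply cov p v (mdifferentiableAt_coordField b hx), mvfderiv_eq_zero,
    zero_apply, zero_sub]

theorem covDerivExtend_symm (htor : cov.torsion = 0) (x : M)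
    (p : TangentSpace 𝓘(ℝ, E) x →L[ℝ] ℝ) (u v : TangentSpace 𝓘(ℝ, E) x) :
    covDerivExtend cov p u v = covDerivExtend cov p v u := by
  have hx := mem_chart_source E x
  rw [← coordField_chartDeriv hx u, ← coordField_chartDeriv hx v, covDerivExtend_coordField,
    covDerivExtend_coordField, cov_coordField_comm htor hx]

/-- The second term is there because `(v, 0)` is the velocity of the section which is constant in
the coordinates around `η`, not around `ξ`. -/
theorem chartForm_cotangent_inl {ξ η : CotangentBundle E M}
    (hη : η.1 ∈ (chartAt E ξ.1).source) (Φ : StrongDual ℝ (PhaseSpace E)) (v : E) :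
    chartForm (cotangentModel E) ξ Φ η (show E × (E →L[ℝ] ℝ) from (v, 0)) =
      Φ (chartDeriv 𝓘(ℝ, E) ξ.1 η.1 v, 0)
        + (covDerivExtend cov η.2 v (coordField ξ.1 (verticalPart Φ) η.1)
          + η.2 (cov (coordField ξ.1 (verticalPart Φ)) η.1 v)) := by
  have hX := mdifferentiableAt_coordField (verticalPart Φ) hη
  have deriv_section := (hasMFDerivAt_comp_cotangent (E := E) (G := ℝ) η.1 η.2 _
    (hasMFDerivAt_apply_extChartAt_cotangent hη Φ)).1
  have mdifferentiableAt_momentum : MDifferentiableAt 𝓘(ℝ, E) 𝓘(ℝ, ℝ)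
      (fun y : M ↦ extendCovector η.2 y (coordField ξ.1 (verticalPart Φ) y)) η.1 := by
    have mdifferentiableAt_section := (FiberBundle.mdifferentiableAt_extend 𝓘(ℝ, E) (E →L[ℝ] ℝ)
      (V := fun y : M ↦ TangentSpace 𝓘(ℝ, E) y →L[ℝ] ℝ) η.2).clm_bundle_apply
        (F₁ := E) (F₂ := ℝ) (E₂ := Trivial M ℝ) hX
    rw [mdifferentiableAt_totalSpace] at mdifferentiableAt_section
    exact mdifferentiableAt_section.2
  have deriv_base := hasMFDerivAt_comp_extChartAt (J := 𝓘(ℝ, E)) hη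
    (Φ.comp (ContinuousLinearMap.inl ℝ E (E →L[ℝ] ℝ))).hasFDerivAt
  have deriv_momentum := sub_eq_iff_eq_add.1 (covDerivExtend_apply cov η.2 v hX).symm
  exact (DFunLike.congr_fun (hasMFDerivAt_unique deriv_section
    (deriv_base.add mdifferentiableAt_momentum.hasMFDerivAt)) v).trans
      (congrArg (Φ (chartDeriv 𝓘(ℝ, E) ξ.1 η.1 v, 0) + ·) deriv_momentum)

theorem chartForm_comp_horizontalLift {ξ η : CotangentBundle E M}
    (hη : η.1 ∈ (chartAt E ξ.1).source) (Φ : StrongDual ℝ (PhaseSpace E)) :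
    (chartForm (cotangentModel E) ξ Φ η).comp (horizontalLift cov η) =
      chartForm 𝓘(ℝ, E) ξ.1 (Φ.comp (coordHorizontalLift (christoffel cov ξ.1)
        (extChartAt (cotangentModel E) ξ η))) η.1 := by
  refine ContinuousLinearMap.ext fun v ↦ ?_
  have momentum_eq : η.2.comp (chartDerivSymm 𝓘(ℝ, E) ξ.1 η.1)
      (christoffel cov ξ.1 (extChartAt 𝓘(ℝ, E) ξ.1 η.1) (verticalPart Φ)
        (chartDeriv 𝓘(ℝ, E) ξ.1 η.1 v)) = η.2 (cov (coordField ξ.1 (verticalPart Φ)) η.1 v) := by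
    rw [christoffel_apply cov hη]
    exact congrArg η.2 (chartDerivSymm_chartDeriv hη _)
  calc chartForm (cotangentModel E) ξ Φ η (horizontalLift cov η v)
    _ = chartForm (cotangentModel E) ξ Φ η (show E × (E →L[ℝ] ℝ) from (v, 0))
        - chartForm (cotangentModel E) ξ Φ η
          (show E × (E →L[ℝ] ℝ) from (0, covDerivExtend cov η.2 v)) :=
      clm_prod_apply_neg (G₁ := E) (G₂ := E →L[ℝ] ℝ) (G₃ := ℝ) _ _ _
    _ = Φ (chartDeriv 𝓘(ℝ, E) ξ.1 η.1 v, 0)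
        + (covDerivExtend cov η.2 v (coordField ξ.1 (verticalPart Φ) η.1)
          + η.2 (cov (coordField ξ.1 (verticalPart Φ)) η.1 v))
        - covDerivExtend cov η.2 v (coordField ξ.1 (verticalPart Φ) η.1) :=
      congrArg₂ (· - ·) (chartForm_cotangent_inl cov hη Φ v) (chartForm_cotangent_inr hη Φ _)
    _ = Φ (chartDeriv 𝓘(ℝ, E) ξ.1 η.1 v, 0)
        + η.2 (cov (coordField ξ.1 (verticalPart Φ)) η.1 v) := by ring
    _ = Φ (coordHorizontalLift (christoffel cov ξ.1) (extChartAt (cotangentModel E) ξ η)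
        (chartDeriv 𝓘(ℝ, E) ξ.1 η.1 v)) := by
      rw [apply_coordHorizontalLift, extChartAt_cotangent_apply]
      exact congrArg (Φ (chartDeriv 𝓘(ℝ, E) ξ.1 η.1 v, 0) + ·) momentum_eq.symm

theorem hasChartExpression_horizontalLiftTensor (w : ContravariantTwoTensor 𝓘(ℝ, E) M)
    (ξ : CotangentBundle E M) : HasChartExpression (horizontalLiftTensor cov w) ξ
      (coordLiftTensor (bivectorInChart w ξ.1) (christoffel cov ξ.1)) := by
  intro η hη Φ Ψ
  have hη' := (mem_chartAt_cotangent_source ξ η).1 hη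
  rw [horizontalLiftTensor_apply, chartForm_comp_horizontalLift cov hη',
    chartForm_comp_horizontalLift cov hη', hasChartExpression_bivectorInChart w ξ.1 _ hη',
    coordLiftTensor_apply, extChartAt_cotangent_apply]
  rfl

variable {cov}

/-- Torsion-freeness makes the connection terms of `chartForm_cotangent_inl` cancel, so the
canonical tensor has constant components around any point. -/
theorem hasChartExpression_canonicalPoisson (htor : cov.torsion = 0) (ξ : CotangentBundle E M) :
    HasChartExpression (canonicalPoisson E M) ξ (fun _ ↦ coordCanonicalPoisson E) := by
  intro η hη Φ Ψ
  have hη' := (mem_chartAt_cotangent_source ξ η).1 hη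
  have apply_inl (Φ Ψ : StrongDual ℝ (PhaseSpace E)) : chartForm (cotangentModel E) ξ Φ η
      (show E × (E →L[ℝ] ℝ) from (0, ContinuousLinearMap.comp (M₁ := E)
        (M₂ := E × (E →L[ℝ] ℝ)) (M₃ := ℝ) (chartForm (cotangentModel E) ξ Ψ η)
        (ContinuousLinearMap.inl ℝ E (E →L[ℝ] ℝ)))) =
      Φ (0, Ψ.comp (ContinuousLinearMap.inl ℝ E (E →L[ℝ] ℝ)))
      + (covDerivExtend cov η.2 (coordField ξ.1 (verticalPart Φ) η.1)
          (coordField ξ.1 (verticalPart Ψ) η.1)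
        + η.2 (cov (coordField ξ.1 (verticalPart Ψ)) η.1
          (coordField ξ.1 (verticalPart Φ) η.1))) := by
    rw [chartForm_cotangent_inr hη', ← apply_verticalPart Φ]
    refine (chartForm_cotangent_inl cov hη' Ψ (coordField ξ.1 (verticalPart Φ) η.1)).trans ?_
    rw [chartDeriv_coordField (verticalPart Φ) hη']
    rfl
  refine (canonicalPoisson_apply η (chartForm (cotangentModel E) ξ Φ η)
    (chartForm (cotangentModel E) ξ Ψ η)).trans ?_
  refine (congrArg₂ (· - ·) (apply_inl Φ Ψ) (apply_inl Ψ Φ)).trans ?_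
  rw [coordCanonicalPoisson_apply, covDerivExtend_symm cov htor, cov_coordField_comm htor hη']
  ring

end CotangentChart

section BracketInChart

variable {F : Type*} [NormedAddCommGroup F] [NormedSpace ℝ F]
  {H : Type*} [TopologicalSpace H] {J : ModelWithCorners ℝ F H}
  {N : Type*} [TopologicalSpace N] [ChartedSpace H N] [IsManifold J ∞ N]
  {P P₁ P₂ : ContravariantTwoTensor J N} {x y : N} {Q Q₁ Q₂ : F → DualBilinForm F}
  {f g h : N → ℝ}

namespace HasChartExpression

theorem contMDiffAt_apply [FiniteDimensional ℝ F] (hP : HasChartExpression P x Q)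
    (hQ : ContDiffAt ℝ ∞ Q (extChartAt J x x)) {α β : ∀ y : N, TangentSpace J y →L[ℝ] ℝ}
    (hα : SmoothOneFormAt α x) (hβ : SmoothOneFormAt β x) :
    ContMDiffAt J 𝓘(ℝ, ℝ) ∞ (fun y ↦ P y (α y) (β y)) x := by
  have hx := mem_chart_source H x
  have contMDiffAt_coord := ((contMDiffAt_comp_extChartAt le_rfl hx hQ).clm_apply
    hα.contMDiffAt_coord).clm_apply hβ.contMDiffAt_coord
  refine contMDiffAt_coord.congr_of_eventuallyEq ?_
  filter_upwards [(chartAt H x).open_source.mem_nhds hx] with y hy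
  rw [← hP y hy, chartForm_coord hy, chartForm_coord hy]

variable [J.Boundaryless]

theorem poissonBracket_eq (hP : HasChartExpression P x Q) (hy : y ∈ (chartAt H x).source)
    (hf : MDifferentiableAt J 𝓘(ℝ, ℝ) f y) (hg : MDifferentiableAt J 𝓘(ℝ, ℝ) g y) :
    poissonBracket P f g y = vectorSpaceBracket Q (f ∘ (extChartAt J x).symm)
      (g ∘ (extChartAt J x).symm) (extChartAt J x y) := by
  rw [poissonBracket, mvfderiv_eq_fderiv hy hf, mvfderiv_eq_fderiv hy hg]
  exact hP y hy _ _

theorem poissonBracket_eventuallyEq (hP : HasChartExpression P x Q)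
    (hf : ContMDiff J 𝓘(ℝ, ℝ) ∞ f) (hg : ContMDiff J 𝓘(ℝ, ℝ) ∞ g) :
    poissonBracket P f g =ᶠ[𝓝 x] fun y ↦ vectorSpaceBracket Q (f ∘ (extChartAt J x).symm)
      (g ∘ (extChartAt J x).symm) (extChartAt J x y) := by
  filter_upwards [(chartAt H x).open_source.mem_nhds (mem_chart_source H x)] with y hy
  exact hP.poissonBracket_eq hy ((hf y).mdifferentiableAt (by simp))
    ((hg y).mdifferentiableAt (by simp))

theorem poissonBracket_poissonBracket (h₁ : HasChartExpression P₁ x Q₁)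
    (h₂ : HasChartExpression P₂ x Q₂) (hQ₁ : DifferentiableAt ℝ Q₁ (extChartAt J x x))
    (hf : ContMDiff J 𝓘(ℝ, ℝ) ∞ f) (hg : ContMDiff J 𝓘(ℝ, ℝ) ∞ g)
    (hh : ContMDiff J 𝓘(ℝ, ℝ) ∞ h) :
    poissonBracket P₂ (poissonBracket P₁ f g) h x =
      vectorSpaceBracket Q₂ (vectorSpaceBracket Q₁ (f ∘ (extChartAt J x).symm)
        (g ∘ (extChartAt J x).symm)) (h ∘ (extChartAt J x).symm) (extChartAt J x x) := by
  have hx := mem_chart_source H x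
  have contDiffAt_two {k : N → ℝ} (hk : ContMDiff J 𝓘(ℝ, ℝ) ∞ k) :
      ContDiffAt ℝ 2 (k ∘ (extChartAt J x).symm) (extChartAt J x x) :=
    contDiffAt_comp_extChartAt_symm (by norm_cast) hx ((hk x).of_le (by norm_cast))
  have hasMFDerivAt_bracket := (hasMFDerivAt_comp_extChartAt hx
    (differentiableAt_vectorSpaceBracket hQ₁ (contDiffAt_two hf)
      (contDiffAt_two hg)).hasFDerivAt).congr_of_eventuallyEq (h₁.poissonBracket_eventuallyEq hf hg)
  have mvfderiv_bracket : mvfderiv J (poissonBracket P₁ f g) x = _ := hasMFDerivAt_bracket.mfderiv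
  rw [poissonBracket, mvfderiv_bracket, mvfderiv_eq_fderiv hx ((hh x).mdifferentiableAt (by simp))]
  exact h₂ x hx _ _

theorem schoutenBracket_eq [FiniteDimensional ℝ F] (h₁ : HasChartExpression P₁ x Q₁)
    (h₂ : HasChartExpression P₂ x Q₂) (hQ₁ : DifferentiableAt ℝ Q₁ (extChartAt J x x))
    (hQ₂ : DifferentiableAt ℝ Q₂ (extChartAt J x x))
    (skew₁ : ∀ Φ Ψ, Q₁ (extChartAt J x x) Φ Ψ = -Q₁ (extChartAt J x x) Ψ Φ)
    (skew₂ : ∀ Φ Ψ, Q₂ (extChartAt J x x) Φ Ψ = -Q₂ (extChartAt J x x) Ψ Φ)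
    (hf : ContMDiff J 𝓘(ℝ, ℝ) ∞ f) (hg : ContMDiff J 𝓘(ℝ, ℝ) ∞ g)
    (hh : ContMDiff J 𝓘(ℝ, ℝ) ∞ h) {Φ Ψ Θ : StrongDual ℝ F}
    (hΦ : fderiv ℝ (f ∘ (extChartAt J x).symm) (extChartAt J x x) = Φ)
    (hΨ : fderiv ℝ (g ∘ (extChartAt J x).symm) (extChartAt J x x) = Ψ)
    (hΘ : fderiv ℝ (h ∘ (extChartAt J x).symm) (extChartAt J x x) = Θ) :
    schoutenBracket P₁ P₂ f g h x =
      -(cyclicSharpDeriv Q₁ (Q₂ (extChartAt J x x)) (extChartAt J x x) Φ Ψ Θ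
        + cyclicSharpDeriv Q₂ (Q₁ (extChartAt J x x)) (extChartAt J x x) Φ Ψ Θ) := by
  have contDiffAt_two {k : N → ℝ} (hk : ContMDiff J 𝓘(ℝ, ℝ) ∞ k) :
      ContDiffAt ℝ 2 (k ∘ (extChartAt J x).symm) (extChartAt J x x) :=
    contDiffAt_comp_extChartAt_symm (by norm_cast) (mem_chart_source H x)
      ((hk x).of_le (by norm_cast))
  rw [schoutenBracket, h₁.poissonBracket_poissonBracket h₂ hQ₁ hf hg hh,
    h₁.poissonBracket_poissonBracket h₂ hQ₁ hg hh hf,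
    h₁.poissonBracket_poissonBracket h₂ hQ₁ hh hf hg,
    h₂.poissonBracket_poissonBracket h₁ hQ₂ hf hg hh,
    h₂.poissonBracket_poissonBracket h₁ hQ₂ hg hh hf,
    h₂.poissonBracket_poissonBracket h₁ hQ₂ hh hf hg,
    sum_vectorSpaceBracket_vectorSpaceBracket hQ₁ hQ₂ skew₁ skew₂ (contDiffAt_two hf)
      (contDiffAt_two hg) (contDiffAt_two hh), hΦ, hΨ, hΘ]

end HasChartExpression

theorem IsBivectorField.isPoisson_of_areCompatible_self (hP : IsBivectorField P)
    (hcompat : AreCompatible P P) : IsPoisson P := by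
  refine ⟨hP, fun f g h hf hg hh x ↦ ?_⟩
  have two_mul_jacobiator := hcompat f g h hf hg hh x
  unfold schoutenBracket at two_mul_jacobiator
  linarith

end BracketInChart

section HorizontalLift

variable {E : Type*} [NormedAddCommGroup E] [NormedSpace ℝ E]
  {M : Type*} [TopologicalSpace M] [ChartedSpace E M] [IsManifold 𝓘(ℝ, E) ∞ M]

theorem extChartAt_cotangent_symm_eventually_mem (ξ : CotangentBundle E M) {s : Set M}
    (hs : s ∈ 𝓝 ξ.1) : ∀ᶠ z in 𝓝 (extChartAt (cotangentModel E) ξ ξ),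
      ((extChartAt (cotangentModel E) ξ).symm z).1 ∈ s := by
  have continuousAt_symm := continuousAt_extChartAt_symm (I := cotangentModel E) ξ
  rw [ContinuousAt, extChartAt_to_inv] at continuousAt_symm
  exact continuousAt_symm.eventually ((FiberBundle.continuous_proj (E →L[ℝ] ℝ)
    (fun y : M ↦ TangentSpace 𝓘(ℝ, E) y →L[ℝ] ℝ)).continuousAt.eventually hs)

theorem extChartAt_cotangent_self (ξ : CotangentBundle E M) :
    extChartAt (cotangentModel E) ξ ξ =
      (extChartAt 𝓘(ℝ, E) ξ.1 ξ.1, ξ.2.comp (chartDerivSymm 𝓘(ℝ, E) ξ.1 ξ.1)) :=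
  extChartAt_cotangent_apply ξ ξ

variable [FiniteDimensional ℝ E] [T2Space M]

theorem exists_contMDiff_cotangent_fderiv_eq (ξ : CotangentBundle E M)
    (Φ : StrongDual ℝ (PhaseSpace E)) : ∃ f : CotangentBundle E M → ℝ,
      ContMDiff (cotangentModel E) 𝓘(ℝ, ℝ) ∞ f ∧
        fderiv ℝ (f ∘ (extChartAt (cotangentModel E) ξ).symm)
          (extChartAt (cotangentModel E) ξ ξ) = Φ := by
  obtain ⟨ρ, -, hρ⟩ := (SmoothBumpFunction.nhds_basis_tsupport (I := 𝓘(ℝ, E)) ξ.1).mem_iff.1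
    ((chartAt E ξ.1).open_source.mem_nhds (mem_chart_source E ξ.1))
  have contMDiff_proj : ContMDiff (cotangentModel E) 𝓘(ℝ, E) ∞
      (TotalSpace.proj : CotangentBundle E M → M) := contMDiff_proj _
  refine ⟨fun η ↦ ρ η.1 * Φ (extChartAt (cotangentModel E) ξ η), fun η ↦ ?_, ?_⟩
  · by_cases hη : η.1 ∈ tsupport ρ
    · exact (ρ.contMDiff.contMDiffAt.comp η (contMDiff_proj η)).mul (contMDiffAt_comp_extChartAt
        le_rfl ((mem_chartAt_cotangent_source ξ η).2 (hρ hη)) Φ.contDiff.contDiffAt)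
    · refine (contMDiffAt_const (c := (0 : ℝ))).congr_of_eventuallyEq ?_
      filter_upwards [contMDiff_proj.continuous.continuousAt.eventually
        ((isClosed_tsupport ρ).isOpen_compl.mem_nhds hη)] with ζ hζ
      rw [image_eq_zero_of_notMem_tsupport hζ, zero_mul]
  · have eventually_eq : (fun η ↦ ρ η.1 * Φ (extChartAt (cotangentModel E) ξ η)) ∘
        (extChartAt (cotangentModel E) ξ).symm =ᶠ[𝓝 (extChartAt (cotangentModel E) ξ ξ)] Φ := by
      filter_upwards [extChartAt_cotangent_symm_eventually_mem ξ ρ.eventuallyEq_one,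
        extChartAt_target_mem_nhds (I := cotangentModel E) ξ] with z hz hz_target
      have bump_eq_one : ρ ((extChartAt (cotangentModel E) ξ).symm z).1 = 1 := hz
      rw [Function.comp_apply, bump_eq_one, (extChartAt (cotangentModel E) ξ).right_inv hz_target,
        one_mul]
    rw [eventually_eq.fderiv_eq, Φ.fderiv]

theorem areCompatible_cotangent_iff_forall_cyclicSharpDeriv
    {P₁ P₂ : ContravariantTwoTensor (cotangentModel E) (CotangentBundle E M)}
    {Q₁ Q₂ : CotangentBundle E M → PhaseSpace E → DualBilinForm (PhaseSpace E)}
    (h₁ : ∀ ξ, HasChartExpression P₁ ξ (Q₁ ξ)) (h₂ : ∀ ξ, HasChartExpression P₂ ξ (Q₂ ξ))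
    (hQ₁ : ∀ ξ, DifferentiableAt ℝ (Q₁ ξ) (extChartAt (cotangentModel E) ξ ξ))
    (hQ₂ : ∀ ξ, DifferentiableAt ℝ (Q₂ ξ) (extChartAt (cotangentModel E) ξ ξ))
    (skew₁ : ∀ ξ Φ Ψ, Q₁ ξ (extChartAt (cotangentModel E) ξ ξ) Φ Ψ =
      -Q₁ ξ (extChartAt (cotangentModel E) ξ ξ) Ψ Φ)
    (skew₂ : ∀ ξ Φ Ψ, Q₂ ξ (extChartAt (cotangentModel E) ξ ξ) Φ Ψ =
      -Q₂ ξ (extChartAt (cotangentModel E) ξ ξ) Ψ Φ) :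
    AreCompatible P₁ P₂ ↔ ∀ ξ Φ Ψ Θ,
      cyclicSharpDeriv (Q₁ ξ) (Q₂ ξ (extChartAt (cotangentModel E) ξ ξ))
          (extChartAt (cotangentModel E) ξ ξ) Φ Ψ Θ
        + cyclicSharpDeriv (Q₂ ξ) (Q₁ ξ (extChartAt (cotangentModel E) ξ ξ))
          (extChartAt (cotangentModel E) ξ ξ) Φ Ψ Θ = 0 := by
  constructor
  · intro hcompat ξ Φ Ψ Θ
    obtain ⟨f, hf, hfΦ⟩ := exists_contMDiff_cotangent_fderiv_eq ξ Φ
    obtain ⟨g, hg, hgΨ⟩ := exists_contMDiff_cotangent_fderiv_eq ξ Ψ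
    obtain ⟨h, hh, hhΘ⟩ := exists_contMDiff_cotangent_fderiv_eq ξ Θ
    rw [← neg_eq_zero, ← hcompat f g h hf hg hh ξ, (h₁ ξ).schoutenBracket_eq (h₂ ξ) (hQ₁ ξ) (hQ₂ ξ)
      (skew₁ ξ) (skew₂ ξ) hf hg hh hfΦ hgΨ hhΘ]
  · intro hcyclic f g h hf hg hh ξ
    rw [(h₁ ξ).schoutenBracket_eq (h₂ ξ) (hQ₁ ξ) (hQ₂ ξ) (skew₁ ξ) (skew₂ ξ) hf hg hh rfl rfl rfl,
      hcyclic, neg_zero]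

variable {w : ContravariantTwoTensor 𝓘(ℝ, E) M}
  {cov : CovariantDerivative 𝓘(ℝ, E) E (TangentSpace 𝓘(ℝ, E) : M → Type _)}

theorem contDiffAt_coordLiftTensor_christoffel (hw : IsBivectorField w)
    (hcov : IsPoissonConnection cov w) (ξ : CotangentBundle E M) :
    ContDiffAt ℝ ∞ (coordLiftTensor (bivectorInChart w ξ.1) (christoffel cov ξ.1))
      (extChartAt (cotangentModel E) ξ ξ) := by
  rw [extChartAt_cotangent_self]
  exact contDiffAt_coordLiftTensor (contDiffAt_bivectorInChart hw ξ.1)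
    (contDiffAt_christoffel hcov.smooth ξ.1)

theorem coordLiftTensor_christoffel_skew (hw : IsBivectorField w)
    (hcov : IsPoissonConnection cov w) (ξ : CotangentBundle E M)
    (Φ Ψ : StrongDual ℝ (PhaseSpace E)) :
    coordLiftTensor (bivectorInChart w ξ.1) (christoffel cov ξ.1)
        (extChartAt (cotangentModel E) ξ ξ) Φ Ψ =
      -coordLiftTensor (bivectorInChart w ξ.1) (christoffel cov ξ.1)
        (extChartAt (cotangentModel E) ξ ξ) Ψ Φ := by
  rw [extChartAt_cotangent_self]
  exact (isPoissonChristoffel_christoffel hcov hw ξ.1).skew _ _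

theorem isBivectorField_horizontalLiftTensor (hw : IsBivectorField w)
    (hcov : IsPoissonConnection cov w) : IsBivectorField (horizontalLiftTensor cov w) where
  smooth _ _ ξ hα hβ := (hasChartExpression_horizontalLiftTensor cov w ξ).contMDiffAt_apply
    (contDiffAt_coordLiftTensor_christoffel hw hcov ξ) hα hβ
  skew ξ _ _ := hw.skew ξ.1 _ _

theorem isPoisson_horizontalLiftTensor (hw : IsBivectorField w) (hcov : IsPoissonConnection cov w)
    (hflat : ∀ (x : M) (u v : E) (α : StrongDual ℝ E),
      christoffelCurvature (christoffel cov x) (extChartAt 𝓘(ℝ, E) x x) u v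
        (sharp (bivectorInChart w x (extChartAt 𝓘(ℝ, E) x x)) α) = 0) :
    IsPoisson (horizontalLiftTensor cov w) := by
  refine (isBivectorField_horizontalLiftTensor hw hcov).isPoisson_of_areCompatible_self ?_
  have lift_expr := hasChartExpression_horizontalLiftTensor cov w
  have lift_differentiable (ξ : CotangentBundle E M) :=
    (contDiffAt_coordLiftTensor_christoffel hw hcov ξ).differentiableAt (by simp)
  have lift_skew := coordLiftTensor_christoffel_skew hw hcov
  refine (areCompatible_cotangent_iff_forall_cyclicSharpDeriv lift_expr lift_expr
    lift_differentiable lift_differentiable lift_skew lift_skew).2 fun ξ Φ Ψ Θ ↦ ?_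
  rw [extChartAt_cotangent_self, (isPoissonChristoffel_christoffel hcov hw
    ξ.1).cyclicSharpDeriv_coordLiftTensor_self_eq_zero (hflat ξ.1), add_zero]

theorem areCompatible_horizontalLiftTensor_canonicalPoisson_iff (hw : IsBivectorField w)
    (hcov : IsPoissonConnection cov w) :
    AreCompatible (horizontalLiftTensor cov w) (canonicalPoisson E M) ↔
      ∀ (x : M) (u v : E) (α : StrongDual ℝ E),
        christoffelCurvature (christoffel cov x) (extChartAt 𝓘(ℝ, E) x x) u v
          (sharp (bivectorInChart w x (extChartAt 𝓘(ℝ, E) x x)) α) = 0 := by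
  rw [areCompatible_cotangent_iff_forall_cyclicSharpDeriv
    (hasChartExpression_horizontalLiftTensor cov w)
    (hasChartExpression_canonicalPoisson hcov.torsion_free)
    (fun ξ ↦ (contDiffAt_coordLiftTensor_christoffel hw hcov ξ).differentiableAt (by simp))
    (fun _ ↦ differentiableAt_const _) (coordLiftTensor_christoffel_skew hw hcov)
    (fun _ ↦ coordCanonicalPoisson_skew)]
  simp only [cyclicSharpDeriv_const_coordCanonicalPoisson, add_zero, extChartAt_cotangent_self]
  have fibrewise (x : M) := (isPoissonChristoffel_christoffel hcov hw
    x).forall_cyclicSharpDeriv_coordCanonicalPoisson_eq_zero_iff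
  refine ⟨fun hcyclic x ↦ (fibrewise x).1 fun p ↦ ?_,
    fun hflat ξ ↦ (fibrewise ξ.1).2 (hflat ξ.1) _⟩
  have momentum_eq : (chartForm 𝓘(ℝ, E) x p x).comp (chartDerivSymm 𝓘(ℝ, E) x x) = p := by
    ext b
    exact congrArg p (chartDeriv_chartDerivSymm (mem_chart_source E x) b)
  rw [← momentum_eq]
  exact hcyclic ⟨x, chartForm 𝓘(ℝ, E) x p x⟩

end HorizontalLift

theorem proposition3p9_general {E : Type*} [NormedAddCommGroup E] [NormedSpace ℝ E]
    [FiniteDimensional ℝ E] {M : Type*} [TopologicalSpace M] [T2Space M] [ChartedSpace E M]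
    [IsManifold 𝓘(ℝ, E) ∞ M] (w : ContravariantTwoTensor 𝓘(ℝ, E) M) (hw : IsBivectorField w)
    (cov : CovariantDerivative 𝓘(ℝ, E) E (TangentSpace 𝓘(ℝ, E) : M → Type _))
    (hcov : IsPoissonConnection cov w) :
    (IsPoisson (horizontalLiftTensor cov w) ∧
        AreCompatible (horizontalLiftTensor cov w) (canonicalPoisson E M)) ↔
      ∀ α : ∀ y : M, TangentSpace 𝓘(ℝ, E) y →L[ℝ] ℝ, (∀ x, SmoothOneFormAt α x) →
        ∀ X Y : ∀ y : M, TangentSpace 𝓘(ℝ, E) y,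
          IsSmoothVectorField X → IsSmoothVectorField Y →
            ∀ x : M, connectionCurvature cov X Y (fun y ↦ bivectorSharp w y (α y)) x = 0 := by
  rw [forall_connectionCurvature_bivectorSharp_eq_zero_iff hw hcov,
    areCompatible_horizontalLiftTensor_canonicalPoisson_iff hw hcov]
  exact and_iff_right_of_imp (isPoisson_horizontalLiftTensor hw hcov)

theorem proposition3p9 {E : Type*} [NormedAddCommGroup E] [NormedSpace ℝ E]
    [FiniteDimensional ℝ E] {M : Type*} [TopologicalSpace M] [T2Space M] [ChartedSpace E M]
    [IsManifold 𝓘(ℝ, E) ∞ M] (w : ContravariantTwoTensor 𝓘(ℝ, E) M) (hw : IsPoisson w)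
    (hreg : IsRegularBivector w)
    (cov : CovariantDerivative 𝓘(ℝ, E) E (TangentSpace 𝓘(ℝ, E) : M → Type _))
    (hcov : IsPoissonConnection cov w) :
    (IsPoisson (horizontalLiftTensor cov w) ∧
        AreCompatible (horizontalLiftTensor cov w) (canonicalPoisson E M)) ↔
      ∀ α : ∀ y : M, TangentSpace 𝓘(ℝ, E) y →L[ℝ] ℝ, (∀ x, SmoothOneFormAt α x) →
        ∀ X Y : ∀ y : M, TangentSpace 𝓘(ℝ, E) y,
          IsSmoothVectorField X → IsSmoothVectorField Y →
            ∀ x : M, connectionCurvature cov X Y (fun y ↦ bivectorSharp w y (α y)) x = 0 :=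
  proposition3p9_general w hw.isBivectorField cov hcov

end
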